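/- All graphs are finite and undirected and may have multiple edges, whole-loops (contributing $2$ to the diagonal entry of the adjacency matrix) and half-loops (contributing $1$). A $d$-regular graph on $n$ vertices is called a $\gamma$-spreader if $|\Gamma(A)|\ge(1+\gamma)|A|$ for every set $A$ of at most $n/2$ vertices, where $\Gamma(A)$ is the set of vertices joined by an edge to some member of $A$. Write $\lambda_1(G)\ge\dots\ge\lambda_n(G)$ for the eigenvalues of the adjacency matrix of $G$. Consider the following models of a random $d$-regular graph on $\{1,\dots,n\}$: - $\mathcal G_{n,d}$ ($d$ even): choose $d/2$ independent uniformly random permutations $\pi_1,\dots,\pi_{d/2}$ of $\{1,\dots,n\}$; for all $i,j$ put in an undirected edge joining $i$ to $\pi_j(i)$ (a whole-loop if $\pi_j(i)=i$); - $\mathcal H_{n,d}$ ($d$ even): the same, but with the $\pi_j$ independent and uniform among the permutations that consist of a single cycle of length $n$; - $\mathcal I_{n,d}$ ($n$ even): the union, with multiplicity, of $d$ independent uniformly random perfect matchings of $\{1,\dots,n\}$; - $\mathcal J_{n,d}$ ($n$ odd): the union, with multiplicity, of $d$ independent uniformly random matchings of $n-1$ of the $n$ vertices, each completed by a half-loop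 at its unmatched vertex. Let $$\tau_{\rm fund}=\Bigl\lceil\frac{\sqrt{d-1}+1}{2}\Bigr\rceil-1\ \text{ for }\mathcal G_{n,d},\qquad \tau_{\rm fund}=\bigl\lceil\sqrt{d-1}\,\bigr\rceil-1\ \text{ for }\mathcal H_{n,d},\ \mathcal I_{n,d},\ \mathcal J_{n,d}.$$ **Theorem.** Let $d\ge4$ be even for the models $\mathcal G_{n,d}$ and $\mathcal H_{n,d}$, and let $d\ge3$ be any integer for the models $\mathcal I_{n,d}$ and $\mathcal J_{n,d}$. For each of these models there are $\gamma>0$, $\varepsilon>0$ and $C$, depending only on $d$ and the model, such that for every $n\ge1$ (with $n$ even for $\mathcal I_{n,d}$ and $n$ odd for $\mathcal J_{n,d}$) a random graph $G$ of the model satisfies the following with probability at least $1-C\,n^{-\tau_{\rm fund}}$: $G$ is a $\gamma$-spreader, and $|\lambda_i(G)|\le d-\varepsilon$ for all $i>1$. -/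

import Mathlib

noncomputable section

/-- A finite undirected graph on the vertex set `V`, with multiple edges, whole-loops and half-loops:
a directed multigraph whose edges are paired by an involution `opp` reversing the direction.
An edge `e` from `v` to `v` with `opp e = e` is a half-loop; a pair `{e, opp e}` of distinct edges
from `v` to `v` is a whole-loop. -/
structure LoopGraph (V : Type) where
  E : Type
  finite_edges : Finite E
  src : E → V
  tgt : E → V
  opp : E → E
  opp_opp : ∀ e, opp (opp e) = e
  src_opp : ∀ e, src (opp e) = tgt e

namespace LoopGraph

/-- The adjacency matrix: `(u, v)` counts the directed edges from `u` to `v`, so that a half-loop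
at `v` contributes `1` and a whole-loop at `v` contributes `2` to the entry `(v, v)`. -/
def adj {V : Type} (G : LoopGraph V) : Matrix V V ℝ :=
  fun u v => (Nat.card {e : G.E // G.src e = u ∧ G.tgt e = v} : ℝ)

theorem tgt_opp {V : Type} (G : LoopGraph V) (e : G.E) : G.tgt (G.opp e) = G.src e := by
  rw [← G.src_opp (G.opp e), G.opp_opp]

theorem adj_isHermitian {V : Type} (G : LoopGraph V) : G.adj.IsHermitian := by
  refine Matrix.IsHermitian.ext fun u v => ?_
  simp only [adj, star_trivial]
  congr 1
  exact Nat.card_congr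
    { toFun := fun e => ⟨G.opp e.1, by rw [G.src_opp]; exact e.2.2, by rw [G.tgt_opp]; exact e.2.1⟩
      invFun := fun e => ⟨G.opp e.1, by rw [G.src_opp]; exact e.2.2, by rw [G.tgt_opp]; exact e.2.1⟩
      left_inv := fun e => Subtype.ext (G.opp_opp e.1)
      right_inv := fun e => Subtype.ext (G.opp_opp e.1) }

/-- The eigenvalues of the adjacency matrix, with multiplicity and in decreasing order; the index
starts at `0`, so `G.eigenvalue i` is what is usually written `λ_{i+1}(G)`. -/
def eigenvalue {V : Type} [Fintype V] [DecidableEq V] (G : LoopGraph V)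
    (i : Fin (Fintype.card V)) : ℝ :=
  G.adj_isHermitian.eigenvalues₀ i

/-- `G` is `d`-regular: every vertex is the origin of exactly `d` directed edges. -/
def IsRegular {V : Type} (G : LoopGraph V) (d : ℕ) : Prop :=
  ∀ v, Nat.card {e : G.E // G.src e = v} = d

/-- `Γ(A)`: the vertices that are joined to some member of `A` by an edge. -/
def neighbors {V : Type} (G : LoopGraph V) (A : Set V) : Set V :=
  {v | ∃ e, G.src e ∈ A ∧ G.tgt e = v}

/-- `G` is a `d`-regular `γ`-spreader: `G` is `d`-regular and `|Γ(A)| ≥ (1 + γ)|A|` for every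
set `A` of at most half of the vertices. -/
def IsSpreader {V : Type} (G : LoopGraph V) (d : ℕ) (γ : ℝ) : Prop :=
  G.IsRegular d ∧
    ∀ A : Set V, (A.ncard : ℝ) ≤ (Nat.card V : ℝ) / 2 →
      (1 + γ) * (A.ncard : ℝ) ≤ ((G.neighbors A).ncard : ℝ)

/-- `|λ_i(G)| ≤ b` for all `i > 1`. -/
def NontrivialEigenvaluesLE {V : Type} [Fintype V] [DecidableEq V] (G : LoopGraph V)
    (b : ℝ) : Prop :=
  ∀ i : Fin (Fintype.card V), 0 < i.val → |G.eigenvalue i| ≤ b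

/-- The graph of a `k`-tuple of permutations: for each `j` and `v` it has the edge
`(v, π j v)`, paired with the opposite edge `(π j v, v)`. -/
def ofPerms {V : Type} [Finite V] {k : ℕ} (π : Fin k → Equiv.Perm V) : LoopGraph V where
  E := Fin k × V × Bool
  finite_edges := inferInstance
  src := fun e => if e.2.2 then e.2.1 else π e.1 e.2.1
  tgt := fun e => if e.2.2 then π e.1 e.2.1 else e.2.1
  opp := fun e => (e.1, e.2.1, !e.2.2)
  opp_opp := by rintro ⟨j, v, b⟩; simp
  src_opp := by rintro ⟨j, v, b⟩; cases b <;> simp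

/-- The graph of a `k`-tuple of involutions: for each `j` and `v` it has the directed edge
`(v, σ j v)`, and the edges of label `j` at `v` and at `σ j v` are paired. So a two-element orbit
of `σ j` gives one undirected edge, and a fixed point gives a half-loop. -/
def ofInvolutions {V : Type} [Finite V] {k : ℕ} (σ : Fin k → Equiv.Perm V)
    (hσ : ∀ j v, σ j (σ j v) = v) : LoopGraph V where
  E := Fin k × V
  finite_edges := inferInstance
  src := fun e => e.2
  tgt := fun e => σ e.1 e.2
  opp := fun e => (e.1, σ e.1 e.2)
  opp_opp := by rintro ⟨j, v⟩; simp [hσ]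
  src_opp := by rintro ⟨j, v⟩; rfl

end LoopGraph

/-- Permutations of `{1, …, n}` whose cyclic decomposition is one cycle of length `n`. -/
abbrev FullCycle (n : ℕ) : Type :=
  {π : Equiv.Perm (Fin n) // ∀ x y, π.SameCycle x y}

/-- Perfect matchings of `{1, …, n}`, as involutions without fixed points. -/
abbrev PerfectMatching (n : ℕ) : Type :=
  {σ : Equiv.Perm (Fin n) // (∀ x, σ (σ x) = x) ∧ ∀ x, σ x ≠ x}

/-- Near perfect matchings of `{1, …, n}` (one vertex is left unmatched), as involutions with
exactly one fixed point. -/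
abbrev NearPerfectMatching (n : ℕ) : Type :=
  {σ : Equiv.Perm (Fin n) // (∀ x, σ (σ x) = x) ∧ ∃! x, σ x = x}

/-- The probability of the event `P` when an element of the finite set `Ω` is chosen uniformly.
For `Ω = Fin k → S` this is the choice of `k` independent uniform elements of `S`. -/
def uniformProb (Ω : Type) (P : Ω → Prop) : ℝ :=
  (Nat.card {ω : Ω // P ω} : ℝ) / (Nat.card Ω : ℝ)

/-- The probability that a random graph in `𝒢_{n,d}` (`d/2` independent uniform permutations of
`{1, …, n}`, `d` even) has the property `P`. -/
def probG (n d : ℕ) (P : LoopGraph (Fin n) → Prop) : ℝ :=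
  uniformProb (Fin (d / 2) → Equiv.Perm (Fin n)) fun π => P (LoopGraph.ofPerms π)

/-- The same for `ℋ_{n,d}`: `d/2` independent uniform permutations that are cycles of length `n`
(`d` even). -/
def probH (n d : ℕ) (P : LoopGraph (Fin n) → Prop) : ℝ :=
  uniformProb (Fin (d / 2) → FullCycle n) fun π => P (LoopGraph.ofPerms fun j => (π j).1)

/-- The same for `ℐ_{n,d}`: `d` independent uniform perfect matchings (`n` even). -/
def probI (n d : ℕ) (P : LoopGraph (Fin n) → Prop) : ℝ :=
  uniformProb (Fin d → PerfectMatching n) fun σ =>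
    P (LoopGraph.ofInvolutions (fun j => (σ j).1) fun j => (σ j).2.1)

/-- The same for `𝒥_{n,d}`: `d` independent uniform near perfect matchings, each completed by a
half-loop at its unmatched vertex (`n` odd). -/
def probJ (n d : ℕ) (P : LoopGraph (Fin n) → Prop) : ℝ :=
  uniformProb (Fin d → NearPerfectMatching n) fun σ =>
    P (LoopGraph.ofInvolutions (fun j => (σ j).1) fun j => (σ j).2.1)

/-- `τ_fund` of the model `𝒢_{n,d}`. -/
def tauFundG (d : ℕ) : ℤ := ⌈(Real.sqrt ((d : ℝ) - 1) + 1) / 2⌉ - 1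

/-- `τ_fund` of the models `ℋ_{n,d}`, `ℐ_{n,d}` and `𝒥_{n,d}`. -/
def tauFundHIJ (d : ℕ) : ℤ := ⌈Real.sqrt ((d : ℝ) - 1)⌉ - 1

end

/-! The spectral bound is a deterministic consequence of expansion. If `Γ(S)` exceeds `S` by `γ|S|`,
then the square of the adjacency matrix, read as a weight on pairs of vertices, has cuts of weight
at least `γ|S|`. Using the square also controls eigenvalues near `-d`. Cheeger's inequality
(`dirichlet_ge_of_cut`) makes the adjacency operator contract mean-zero functions
(`sum_sq_adj_mulVec_le`), which gives the gap `γ²/(4d³)`.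

Expansion comes from a union bound with `γ = 1/S₀`. If `A` violates it and `B = Γ(A)`, every
generating permutation and its inverse map `A` into `B`, and `B` is barely larger than `A`. When
`|A| < S₀` this forces `|B| = |A|`, and `A ∪ B` is a small set invariant under all generators
(`exists_invariant_or_joining`). Such sets account for the polynomial failure probability: order
`n^(-(d/2-1))` for `𝒢`, order `n^(-(d-2))` for `ℐ` and `𝒥`, none at all for `ℋ`. These exponents are
at least `τ_fund`.

For `|A| ≥ S₀` let `N` be the size of the orbit of `(A, B)` under the symmetric group and `r = |B| -
|A|`. A random permutation joins `A` to `B` with probability at most `C(n,r)²/N`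
(`card_joiningPerms_mul_le`). The sum of `1/N` over all pairs of given sizes is at most `n + 1`,
because each orbit contributes `1` (`sum_inv_card_similarPairs_le`). So any probability of order
`N^(-3/2)`, up to powers of `n` and of `C(n,r)`, is summable: the surplus `N^(-1/2)` absorbs these
factors since `r` is a small fraction of `|A|`. Two permutations suffice for this. A matching counts
as half a permutation, as two matchings weave injectively into one permutation
(`card_joiningMatchings_sq_le`), so three matchings give exactly the exponent `3/2`. Near perfect
matchings become perfect when a vertex is added. -/

namespace LoopGraph

/-! ### Cheeger's inequality for weighted graphs. -/

section Cheeger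

variable {V : Type} [Fintype V] [DecidableEq V]

/-- A weight function all of whose small cuts are large satisfies an `ℓ¹` Poincaré inequality for
nonnegative functions with small support. -/
theorem sum_abs_sub_ge_of_cut (M : V → V → ℝ) (h : ℝ)
    (hcut : ∀ S : Finset V, 2 * S.card ≤ Fintype.card V →
      h * S.card ≤ ∑ u ∈ S, ∑ v ∈ Sᶜ, M u v) (hsymm : ∀ u v, M u v = M v u)
    (F : V → ℝ) (hF : ∀ v, 0 ≤ F v)
    (hsupp : 2 * (Finset.univ.filter fun v => F v ≠ 0).card ≤ Fintype.card V) :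
    2 * h * ∑ v, F v ≤ ∑ u, ∑ v, M u v * |F u - F v| := by
  generalize hk : (Finset.univ.filter fun v => F v ≠ 0).card = k at hsupp
  induction k using Nat.strong_induction_on generalizing F with
  | _ k ih =>
  set S := Finset.univ.filter fun v => F v ≠ 0 with hS
  have hmem : ∀ v, v ∈ S ↔ F v ≠ 0 := fun v => by simp [hS]
  rcases S.eq_empty_or_nonempty with hSe | hSn
  · have h0 : ∀ v, F v = 0 := fun v => by
      by_contra hv
      have := (hmem v).2 hv
      simp [hSe] at this
    simp [h0]
  -- Discrete coarea formula: peel off the lowest layer `m · 1_S`. The minimizer `w` leaves the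
  -- support, so the induction descends.
  obtain ⟨w, hwS, hw⟩ := S.exists_min_image F hSn
  set m := F w with hm
  have hmpos : 0 < m := lt_of_le_of_ne (hF w) (Ne.symm ((hmem w).1 hwS))
  let F' : V → ℝ := fun v => if v ∈ S then F v - m else 0
  have hF'0 : ∀ v, 0 ≤ F' v := fun v => by
    by_cases hv : v ∈ S
    · simp only [F', hv, if_true]; linarith [hw v hv]
    · simp [F', hv]
  have hsub : (Finset.univ.filter fun v => F' v ≠ 0) ⊂ S := by
    refine (Finset.ssubset_iff_of_subset ?_).2 ⟨w, hwS, ?_⟩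
    · intro v hv
      by_contra hvS
      simp [F', hvS] at hv
    · simp [F', hwS, hm]
  have hlt : (Finset.univ.filter fun v => F' v ≠ 0).card < k := hk ▸ Finset.card_lt_card hsub
  have key := ih _ hlt F' hF'0 rfl (by omega)
  have hFsum : ∑ v, F v = ∑ v, F' v + m * S.card := by
    have : ∀ v, F v = F' v + (if v ∈ S then m else 0) := fun v => by
      by_cases hv : v ∈ S
      · simp [F', hv]
      · have : F v = 0 := by_contra fun h' => hv ((hmem v).2 h')
        simp [F', hv, this]
    rw [Finset.sum_congr rfl fun v _ => this v, Finset.sum_add_distrib]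
    simp [mul_comm]
  have habs : ∀ u v, |F u - F v| = |F' u - F' v| +
      m * ((if u ∈ S then if v ∈ Sᶜ then 1 else 0 else 0) +
        (if v ∈ S then if u ∈ Sᶜ then 1 else 0 else 0)) := fun u v => by
    by_cases hu : u ∈ S <;> by_cases hv : v ∈ S
    · simp [F', hu, hv]
    · have : F v = 0 := by_contra fun h' => hv ((hmem v).2 h')
      have h1 := hw u hu
      simp only [F', hu, hv, this, Finset.mem_compl, if_true, if_false, not_false_eq_true, sub_zero]
      rw [abs_of_nonneg (hF u), abs_of_nonneg (by linarith)]; ring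
    · have : F u = 0 := by_contra fun h' => hu ((hmem u).2 h')
      have h1 := hw v hv
      simp only [F', hu, hv, this, Finset.mem_compl, if_true, if_false, not_false_eq_true, zero_sub,
        abs_neg]
      rw [abs_of_nonneg (hF v), abs_of_nonneg (by linarith)]; ring
    · have h1 : F v = 0 := by_contra fun h' => hv ((hmem v).2 h')
      have h2 : F u = 0 := by_contra fun h' => hu ((hmem u).2 h')
      simp [F', hu, hv, h1, h2]
  have hcutS := hcut S (by omega)
  have hA : ∑ u, ∑ v, M u v * (if u ∈ S then if v ∈ Sᶜ then (1:ℝ) else 0 else 0)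
      = ∑ u ∈ S, ∑ v ∈ Sᶜ, M u v := by
    rw [← Finset.sum_filter_add_sum_filter_not Finset.univ (· ∈ S)]
    rw [Finset.sum_congr (s₂ := S) (g := fun u => ∑ v ∈ Sᶜ, M u v) (by ext; simp)]
    · rw [Finset.sum_eq_zero (s := Finset.univ.filter (· ∉ S)), add_zero]
      intro u hu
      simp [(Finset.mem_filter.1 hu).2]
    · intro u hu
      simp only [hu, if_true, mul_ite, mul_one, mul_zero]
      rw [← Finset.sum_filter]
      exact Finset.sum_congr (by ext; simp) fun _ _ => rfl
  have hB : ∑ u, ∑ v, M u v * (if v ∈ S then if u ∈ Sᶜ then (1:ℝ) else 0 else 0)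
      = ∑ u ∈ S, ∑ v ∈ Sᶜ, M u v := by
    rw [Finset.sum_comm, ← hA]
    exact Finset.sum_congr rfl fun u _ => Finset.sum_congr rfl fun v _ => by rw [hsymm]
  -- Over ordered pairs the cut of `S` is met in both directions, whence the factor `2`.
  have hsplit : ∑ u, ∑ v, M u v * |F u - F v| = ∑ u, ∑ v, M u v * |F' u - F' v| +
      m * (2 * ∑ u ∈ S, ∑ v ∈ Sᶜ, M u v) := by
    rw [two_mul]
    nth_rewrite 1 [← hA]
    rw [← hB]
    simp only [Finset.mul_sum, ← Finset.sum_add_distrib]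
    refine Finset.sum_congr rfl fun u _ => Finset.sum_congr rfl fun v _ => ?_
    rw [habs]; ring
  rw [hsplit, hFsum]
  nlinarith [mul_le_mul_of_nonneg_left hcutS hmpos.le]

/-- The Dirichlet form of a function with small support. -/
theorem dirichlet_ge_of_cut_of_card_support (M : V → V → ℝ) (h D : ℝ) (hh : 0 < h) (hD : 0 < D)
    (hM : ∀ u v, 0 ≤ M u v)
    (hcut : ∀ S : Finset V, 2 * S.card ≤ Fintype.card V →
      h * S.card ≤ ∑ u ∈ S, ∑ v ∈ Sᶜ, M u v) (hsymm : ∀ u v, M u v = M v u)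
    (hrow : ∀ u, ∑ v, M u v = D)
    (z : V → ℝ)
    (hsupp : 2 * (Finset.univ.filter fun v => z v ≠ 0).card ≤ Fintype.card V) :
    h ^ 2 / D * ∑ v, z v ^ 2 ≤ ∑ u, ∑ v, M u v * (z u - z v) ^ 2 := by
  have h1 := sum_abs_sub_ge_of_cut M h hcut hsymm (fun v => z v ^ 2) (fun v => sq_nonneg _)
    (by simpa using hsupp)
  have h2 : ∑ u, ∑ v, M u v * |z u ^ 2 - z v ^ 2| ≤
      (D / h) * ∑ u, ∑ v, M u v * (z u - z v) ^ 2 +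
      (h / (4 * D)) * ∑ u, ∑ v, M u v * (2 * z u ^ 2 + 2 * z v ^ 2) := by
    simp only [Finset.mul_sum, ← Finset.sum_add_distrib]
    refine Finset.sum_le_sum fun u _ => Finset.sum_le_sum fun v _ => ?_
    -- Weighted AM-GM. The weight `h / (4 * D)` makes the second sum equal to `h * ∑ z²`, half of
    -- the lower bound in `h1`, so that it can be absorbed.
    have h3 : |z u ^ 2 - z v ^ 2| ≤ D / h * (z u - z v) ^ 2 + h / (4 * D) * (z u + z v) ^ 2 := by
      have : z u ^ 2 - z v ^ 2 = (z u - z v) * (z u + z v) := by ring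
      rw [this, abs_le]
      have e1 : D / h * (z u - z v) ^ 2 + h / (4 * D) * (z u + z v) ^ 2
        - (z u - z v) * (z u + z v) = D / h * ((z u - z v) - h / (2 * D) * (z u + z v)) ^ 2 := by
        field_simp; ring
      have e2 : D / h * (z u - z v) ^ 2 + h / (4 * D) * (z u + z v) ^ 2
        + (z u - z v) * (z u + z v) = D / h * ((z u - z v) + h / (2 * D) * (z u + z v)) ^ 2 := by
        field_simp; ring
      have p1 : 0 ≤ D / h * ((z u - z v) - h / (2 * D) * (z u + z v)) ^ 2 := by positivity
      have p2 : 0 ≤ D / h * ((z u - z v) + h / (2 * D) * (z u + z v)) ^ 2 := by positivity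
      constructor <;> linarith
    have h4 : h / (4 * D) * (z u + z v) ^ 2 ≤ h / (4 * D) * (2 * z u ^ 2 + 2 * z v ^ 2) :=
      mul_le_mul_of_nonneg_left (by nlinarith [sq_nonneg (z u - z v)]) (by positivity)
    calc M u v * |z u ^ 2 - z v ^ 2|
        ≤ M u v * (D / h * (z u - z v) ^ 2 + h / (4 * D) * (2 * z u ^ 2 + 2 * z v ^ 2)) :=
          mul_le_mul_of_nonneg_left (h3.trans (by linarith)) (hM u v)
      _ = _ := by ring
  have h5 : ∑ u, ∑ v, M u v * (2 * z u ^ 2 + 2 * z v ^ 2) = 4 * D * ∑ v, z v ^ 2 := by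
    have e1 : ∑ u, ∑ v, M u v * z u ^ 2 = D * ∑ v, z v ^ 2 := by
      rw [Finset.mul_sum]
      exact Finset.sum_congr rfl fun u _ => by rw [← Finset.sum_mul, hrow]
    have e2 : ∑ u, ∑ v, M u v * z v ^ 2 = D * ∑ v, z v ^ 2 := by
      rw [Finset.sum_comm, ← e1]
      exact Finset.sum_congr rfl fun u _ => Finset.sum_congr rfl fun v _ => by rw [hsymm]
    calc _ = 2 * ∑ u, ∑ v, M u v * z u ^ 2 + 2 * ∑ u, ∑ v, M u v * z v ^ 2 := by
          simp only [Finset.mul_sum, ← Finset.sum_add_distrib]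
          exact Finset.sum_congr rfl fun u _ => Finset.sum_congr rfl fun v _ => by ring
      _ = _ := by rw [e1, e2]; ring
  rw [h5] at h2
  have h6 : h / (4 * D) * (4 * D * ∑ v, z v ^ 2) = h * ∑ v, z v ^ 2 := by field_simp
  rw [h6] at h2
  have h7 : h * ∑ v, z v ^ 2 ≤ (D / h) * ∑ u, ∑ v, M u v * (z u - z v) ^ 2 := by linarith
  calc h ^ 2 / D * ∑ v, z v ^ 2 = h / D * (h * ∑ v, z v ^ 2) := by ring
    _ ≤ h / D * ((D / h) * ∑ u, ∑ v, M u v * (z u - z v) ^ 2) :=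
        mul_le_mul_of_nonneg_left h7 (by positivity)
    _ = _ := by field_simp

/-- The median is the least value with at most half of the vertices above it. The next smaller value
has more than half above it, and these vertices are disjoint from those below the median. -/
theorem exists_median (x : V → ℝ) [Nonempty V] :
    ∃ m : ℝ, 2 * (Finset.univ.filter fun v => m < x v).card ≤ Fintype.card V ∧
      2 * (Finset.univ.filter fun v => x v < m).card ≤ Fintype.card V := by
  classical
  let T := Finset.univ.filter fun w => 2 * (Finset.univ.filter fun v => x w < x v).card ≤
    Fintype.card V
  have hT : T.Nonempty := by
    obtain ⟨w, -, hw⟩ := Finset.univ.exists_max_image x Finset.univ_nonempty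
    refine ⟨w, Finset.mem_filter.2 ⟨Finset.mem_univ _, ?_⟩⟩
    rw [Finset.filter_false_of_mem fun v hv => not_lt.2 (hw v hv)]
    simp
  obtain ⟨w, hwT, hw⟩ := T.exists_min_image x hT
  refine ⟨x w, (Finset.mem_filter.1 hwT).2, ?_⟩
  rcases (Finset.univ.filter fun v => x v < x w).eq_empty_or_nonempty with he | hne
  · simp [he]
  obtain ⟨y, hy, hmax⟩ := Finset.exists_max_image _ x hne
  have hyT : y ∉ T := fun h => absurd (hw y h) (not_le.2 (Finset.mem_filter.1 hy).2)
  have h1 : Fintype.card V < 2 * (Finset.univ.filter fun v => x y < x v).card := by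
    by_contra h
    exact hyT (Finset.mem_filter.2 ⟨Finset.mem_univ _, not_lt.1 h⟩)
  have h2 : Disjoint (Finset.univ.filter fun v => x y < x v)
      (Finset.univ.filter fun v => x v < x w) := by
    rw [Finset.disjoint_left]
    intro v hv hv'
    exact absurd (hmax v hv') (not_le.2 (Finset.mem_filter.1 hv).2)
  have h3 := Finset.card_le_univ ((Finset.univ.filter fun v => x y < x v) ∪
      (Finset.univ.filter fun v => x v < x w))
  rw [Finset.card_union_of_disjoint h2] at h3
  omega

/-- Cheeger's inequality, as a Poincaré inequality. -/
theorem dirichlet_ge_of_cut (M : V → V → ℝ) (h D : ℝ) (hh : 0 < h) (hD : 0 < D)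
    (hM : ∀ u v, 0 ≤ M u v)
    (hcut : ∀ S : Finset V, 2 * S.card ≤ Fintype.card V →
      h * S.card ≤ ∑ u ∈ S, ∑ v ∈ Sᶜ, M u v) (hsymm : ∀ u v, M u v = M v u)
    (hrow : ∀ u, ∑ v, M u v = D) (x : V → ℝ) (hx : ∑ v, x v = 0) :
    h ^ 2 / D * ∑ v, x v ^ 2 ≤ ∑ u, ∑ v, M u v * (x u - x v) ^ 2 := by
  cases isEmpty_or_nonempty V
  · simp
  obtain ⟨m, hm1, hm2⟩ := exists_median x
  have hp := dirichlet_ge_of_cut_of_card_support M h D hh hD hM hcut hsymm hrow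
    (fun v => max (x v - m) 0) (by
      refine le_trans (Nat.mul_le_mul_left 2 (Finset.card_le_card fun v hv => ?_)) hm1
      simp only [ne_eq, Finset.mem_filter, Finset.mem_univ, true_and] at hv ⊢
      by_contra hc
      exact hv (max_eq_right (by linarith)))
  have hn := dirichlet_ge_of_cut_of_card_support M h D hh hD hM hcut hsymm hrow
    (fun v => max (m - x v) 0) (by
      refine le_trans (Nat.mul_le_mul_left 2 (Finset.card_le_card fun v hv => ?_)) hm2
      simp only [ne_eq, Finset.mem_filter, Finset.mem_univ, true_and] at hv ⊢
      by_contra hc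
      exact hv (max_eq_right (by linarith)))
  have h1 : ∀ v, (x v - m) ^ 2 = max (x v - m) 0 ^ 2 + max (m - x v) 0 ^ 2 := fun v => by
    rcases le_total (x v) m with h | h
    · rw [max_eq_right (by linarith), max_eq_left (by linarith)]; ring
    · rw [max_eq_left (by linarith), max_eq_right (by linarith)]; ring
  have h2 : ∀ u v, (max (x u - m) 0 - max (x v - m) 0) ^ 2 +
      (max (m - x u) 0 - max (m - x v) 0) ^ 2 ≤ (x u - x v) ^ 2 := fun u v => by
    rcases le_total (x u) m with h | h <;> rcases le_total (x v) m with h' | h'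
    · rw [max_eq_right (by linarith), max_eq_right (by linarith), max_eq_left (by linarith),
        max_eq_left (by linarith)]; nlinarith
    · rw [max_eq_right (by linarith), max_eq_left (by linarith), max_eq_left (by linarith),
        max_eq_right (by linarith)]; nlinarith
    · rw [max_eq_left (by linarith), max_eq_right (by linarith), max_eq_right (by linarith),
        max_eq_left (by linarith)]; nlinarith
    · rw [max_eq_left (by linarith), max_eq_left (by linarith), max_eq_right (by linarith),
        max_eq_right (by linarith)]; nlinarith
  -- Mean zero enters only here: among all shifts of `x`, the unshifted one has the least norm.
  have h3 : ∑ v, x v ^ 2 ≤ ∑ v, (x v - m) ^ 2 := by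
    have : ∑ v, (x v - m) ^ 2 = ∑ v, x v ^ 2 - 2 * m * ∑ v, x v + ∑ _v : V, m ^ 2 := by
      rw [Finset.mul_sum, ← Finset.sum_sub_distrib, ← Finset.sum_add_distrib]
      exact Finset.sum_congr rfl fun v _ => by ring
    have h0 : 0 ≤ ∑ _v : V, m ^ 2 := Finset.sum_nonneg fun _ _ => sq_nonneg _
    rw [this, hx]; linarith
  calc h ^ 2 / D * ∑ v, x v ^ 2 ≤ h ^ 2 / D * ∑ v, (x v - m) ^ 2 :=
        mul_le_mul_of_nonneg_left h3 (by positivity)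
    _ = h ^ 2 / D * ∑ v, max (x v - m) 0 ^ 2 + h ^ 2 / D * ∑ v, max (m - x v) 0 ^ 2 := by
        rw [← mul_add, ← Finset.sum_add_distrib, Finset.sum_congr rfl fun v _ => h1 v]
    _ ≤ _ := add_le_add hp hn
    _ ≤ _ := by
        simp only [← Finset.sum_add_distrib]
        refine Finset.sum_le_sum fun u _ => Finset.sum_le_sum fun v _ => ?_
        rw [← mul_add]
        exact mul_le_mul_of_nonneg_left (h2 u v) (hM u v)

end Cheeger

end LoopGraph

/-! ### From vertex expansion to the spectrum. -/

namespace LoopGraph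

variable {V : Type} [Fintype V] [DecidableEq V]

theorem sum_adj_row {G : LoopGraph V} {d : ℕ} (hG : G.IsRegular d) (u : V) :
    ∑ v, G.adj u v = d := by
  classical
  have := G.finite_edges
  have := Fintype.ofFinite G.E
  simp only [adj]
  rw [← Nat.cast_sum, ← hG u]
  congr 1
  simp only [Nat.card_eq_fintype_card, Fintype.card_subtype]
  rw [Finset.card_eq_sum_card_fiberwise (f := G.tgt) (t := Finset.univ) (fun _ _ => by simp)]
  simp [Finset.filter_filter]

omit [Fintype V] [DecidableEq V] in
theorem adj_symm (G : LoopGraph V) (u v : V) : G.adj u v = G.adj v u := by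
  simpa using G.adj_isHermitian.apply v u

omit [Fintype V] [DecidableEq V] in
theorem adj_pos_iff (G : LoopGraph V) (u v : V) :
    0 < G.adj u v ↔ ∃ e, G.src e = u ∧ G.tgt e = v := by
  have := G.finite_edges
  simp only [adj, Nat.cast_pos, Nat.card_pos_iff, nonempty_subtype, and_iff_left_iff_imp]
  intro _; infer_instance

/-- Cuts of the square of a spreader are large. -/
theorem cut_sq_adj_ge {G : LoopGraph V} {d : ℕ} {γ : ℝ} (hG : G.IsSpreader d γ)
    (S : Finset V) (hS : 2 * S.card ≤ Fintype.card V) :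
    γ * S.card ≤ ∑ u ∈ S, ∑ v ∈ Sᶜ, ∑ w, G.adj u w * G.adj w v := by
  obtain ⟨hreg, hsp⟩ := hG
  -- `g w` counts the edges from `S` to `w`. A path of length two crosses the cut through `w` in `g
  -- w * (d - g w)` ways.
  let g : V → ℕ := fun w => ∑ u ∈ S, Nat.card {e : G.E // G.src e = u ∧ G.tgt e = w}
  have hg : ∀ w, (g w : ℝ) = ∑ u ∈ S, G.adj u w := fun w => by simp [g, adj]
  have hg' : ∀ w, ∑ v ∈ Sᶜ, G.adj w v = d - g w := fun w => by
    rw [hg, ← sum_adj_row hreg w, ← Finset.sum_add_sum_compl S,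
      Finset.sum_congr rfl fun u _ => G.adj_symm u w]
    ring
  have hgd : ∀ w, g w ≤ d := fun w => by
    have : (0 : ℝ) ≤ d - g w := by
      rw [← hg']; exact Finset.sum_nonneg fun v _ => Nat.cast_nonneg _
    exact_mod_cast sub_nonneg.1 this
  have hsum : ∑ w, g w = d * S.card := by
    have : ((∑ w, g w : ℕ) : ℝ) = d * S.card := by
      push_cast
      rw [Finset.sum_congr rfl fun w _ => hg w, Finset.sum_comm,
        Finset.sum_congr rfl fun u _ => sum_adj_row hreg u]
      simp [mul_comm]
    exact_mod_cast this
  have hcut : ∑ u ∈ S, ∑ v ∈ Sᶜ, ∑ w, G.adj u w * G.adj w v = ∑ w, (g w : ℝ) * (d - g w) := by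
    rw [Finset.sum_congr rfl fun u _ => Finset.sum_comm, Finset.sum_comm]
    refine Finset.sum_congr rfl fun w _ => ?_
    rw [hg, ← hg, ← hg', hg, Finset.sum_mul]
    exact Finset.sum_congr rfl fun u _ => by rw [Finset.mul_sum]
  rw [hcut]
  have hnb : G.neighbors (S : Set V) = {w | 0 < g w} := by
    ext w
    have hpos : 0 < g w ↔ ∃ u ∈ S, 0 < G.adj u w := by
      simp only [g, adj, Nat.cast_pos]
      exact Finset.sum_pos_iff
    rw [Set.mem_ofPred_eq, hpos]
    simp only [adj_pos_iff, neighbors, Set.mem_ofPred_eq, Finset.mem_coe]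
    constructor
    · rintro ⟨e, h1, h2⟩; exact ⟨_, h1, e, rfl, h2⟩
    · rintro ⟨u, hu, e, h1, h2⟩; exact ⟨e, h1 ▸ hu, h2⟩
  have h1 := hsp (S : Set V) (by
    rw [Set.ncard_coe_finset, Nat.card_eq_fintype_card, le_div_iff₀ two_pos]
    exact_mod_cast (by omega : S.card * 2 ≤ Fintype.card V))
  have hset : ({w | 0 < g w} : Set V) = ((Finset.univ.filter fun w => 0 < g w : Finset V) : Set V) := by
    ext; simp
  rw [hnb, hset, Set.ncard_coe_finset, Set.ncard_coe_finset] at h1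
  -- Integrality is used: the right side is at least `1` unless `g w` is `0` or `d`, where both
  -- sides vanish. Summed over `w`, the left side is at least `|Γ(S)| - |S|`.
  have hpt : ∀ w, (if 0 < g w then (1 : ℝ) else 0) - g w / d ≤ g w * (d - g w) := fun w => by
    have hd := hgd w
    rcases Nat.eq_zero_or_pos (g w) with h0 | h0
    · simp [h0]
    · have hd0 : (0 : ℝ) < d := by exact_mod_cast lt_of_lt_of_le h0 hd
      rw [if_pos h0]
      rcases hd.eq_or_lt with he | hl
      · rw [he]; simp [hd0.ne']
      · have a1 : (1 : ℝ) ≤ g w := by exact_mod_cast h0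
        have a2 : (1 : ℝ) ≤ d - g w := by
          have : (g w : ℝ) + 1 ≤ d := by exact_mod_cast hl
          linarith
        have a3 : (0 : ℝ) ≤ g w / d := by positivity
        nlinarith
  have h2 : ∑ w, ((if 0 < g w then (1 : ℝ) else 0) - g w / d) ≤ ∑ w, (g w : ℝ) * (d - g w) :=
    Finset.sum_le_sum fun w _ => hpt w
  rw [Finset.sum_sub_distrib, ← Finset.sum_div, ← Nat.cast_sum, hsum, ← Finset.sum_filter] at h2
  have h3 : ((d * S.card : ℕ) : ℝ) / d ≤ S.card := by
    rcases Nat.eq_zero_or_pos d with h0 | h0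
    · simp [h0]
    · rw [Nat.cast_mul, mul_div_cancel_left₀ _ (by positivity)]
  simp only [Finset.sum_const, nsmul_eq_mul, mul_one] at h2
  linarith

/-- The adjacency operator of a spreader contracts the functions of mean zero. -/
theorem sum_sq_adj_mulVec_le {G : LoopGraph V} {d : ℕ} {γ : ℝ} (hd : 0 < d) (hγ : 0 < γ)
    (hG : G.IsSpreader d γ) (x : V → ℝ) (hx : ∑ v, x v = 0) :
    ∑ w, (G.adj.mulVec x w) ^ 2 ≤ ((d : ℝ) ^ 2 - γ ^ 2 / (2 * d ^ 2)) * ∑ v, x v ^ 2 := by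
  have hd0 : (0 : ℝ) < d := by exact_mod_cast hd
  let M : V → V → ℝ := fun u v => ∑ w, G.adj u w * G.adj w v
  have hsymm : ∀ u v, M u v = M v u := fun u v => Finset.sum_congr rfl fun w _ => by
    rw [G.adj_symm u w, G.adj_symm w v, mul_comm]
  have hrow : ∀ u, ∑ v, M u v = (d : ℝ) ^ 2 := fun u => by
    simp only [M]
    rw [Finset.sum_comm]
    simp only [← Finset.mul_sum, sum_adj_row hG.1, ← Finset.sum_mul]
    ring
  have key := dirichlet_ge_of_cut M γ ((d : ℝ) ^ 2) hγ (by positivity)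
    (fun u v => Finset.sum_nonneg fun w _ => mul_nonneg (Nat.cast_nonneg _) (Nat.cast_nonneg _))
    (fun S hS => cut_sq_adj_ge hG S hS) hsymm hrow x hx
  have e1 : ∑ u, ∑ v, M u v * x u ^ 2 = (d : ℝ) ^ 2 * ∑ v, x v ^ 2 := by
    rw [Finset.mul_sum]
    exact Finset.sum_congr rfl fun u _ => by rw [← Finset.sum_mul, hrow]
  have e2 : ∑ u, ∑ v, M u v * x v ^ 2 = (d : ℝ) ^ 2 * ∑ v, x v ^ 2 := by
    rw [Finset.sum_comm, ← e1]
    exact Finset.sum_congr rfl fun u _ => Finset.sum_congr rfl fun v _ => by rw [hsymm]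
  have e3 : ∑ u, ∑ v, M u v * (x u * x v) = ∑ w, (G.adj.mulVec x w) ^ 2 := by
    simp only [M, Matrix.mulVec, dotProduct, Finset.sum_mul, sq, Finset.mul_sum]
    rw [Finset.sum_congr rfl fun u _ => Finset.sum_comm, Finset.sum_comm]
    refine Finset.sum_congr rfl fun w _ => Finset.sum_comm.trans ?_
    refine Finset.sum_congr rfl fun v _ => Finset.sum_congr rfl fun u _ => ?_
    rw [G.adj_symm u w]; ring
  have e4 : ∑ u, ∑ v, M u v * (x u - x v) ^ 2 = ∑ u, ∑ v, M u v * x u ^ 2 +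
      ∑ u, ∑ v, M u v * x v ^ 2 - 2 * ∑ u, ∑ v, M u v * (x u * x v) := by
    simp only [Finset.mul_sum, ← Finset.sum_add_distrib, ← Finset.sum_sub_distrib]
    exact Finset.sum_congr rfl fun u _ => Finset.sum_congr rfl fun v _ => by ring
  rw [e4, e1, e2, e3] at key
  have : γ ^ 2 / (2 * (d : ℝ) ^ 2) = γ ^ 2 / d ^ 2 / 2 := by field_simp
  rw [this]; linarith

theorem le_eigenvalue_zero {G : LoopGraph V} {d : ℕ} (hG : G.IsRegular d)
    (h : 0 < Fintype.card V) : (d : ℝ) ≤ G.eigenvalue ⟨0, h⟩ := by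
  have : Nonempty V := Fintype.card_pos_iff.1 h
  have hmem : (d : ℝ) ∈ spectrum ℝ G.adj := by
    rw [← Matrix.spectrum_toLin', ← Module.End.hasEigenvalue_iff_mem_spectrum]
    refine Module.End.hasEigenvalue_of_hasEigenvector (x := fun _ => 1)
      (Module.End.hasEigenvector_iff.2 ⟨Module.End.mem_eigenspace_iff.2 ?_, ?_⟩)
    · ext u
      simp [Matrix.toLin'_apply, Matrix.mulVec, dotProduct, sum_adj_row hG]
    · intro h0
      have := congrFun h0 (Classical.arbitrary V)
      simp at this
  rw [G.adj_isHermitian.spectrum_real_eq_range_eigenvalues] at hmem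
  obtain ⟨v, hv⟩ := hmem
  rw [← hv]
  exact G.adj_isHermitian.eigenvalues₀_antitone (Fin.mk_le_mk.2 (Nat.zero_le _))

/-- The plane spanned by the eigenvector of index `0` and another one contains a nonzero mean-zero
vector, to which the contraction applies. Since the top eigenvalue is at least `d`, the other must
be small. This avoids identifying the top eigenvector with the constants, which could fail in a
degenerate eigenspace. -/
theorem IsSpreader.nontrivialEigenvaluesLE {G : LoopGraph V} {d : ℕ} {γ : ℝ} (hd : 0 < d)
    (hγ : 0 < γ) (hγ2 : γ ≤ 1) (hG : G.IsSpreader d γ) :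
    G.NontrivialEigenvaluesLE ((d : ℝ) - γ ^ 2 / (4 * d ^ 3)) := by
  intro i hi
  have hd1 : (1 : ℝ) ≤ d := by exact_mod_cast hd
  have h0 : 0 < Fintype.card V := lt_of_le_of_lt (Nat.zero_le _) i.2
  set hA := G.adj_isHermitian
  let e := Fintype.equivOfCardEq (Fintype.card_fin (Fintype.card V))
  let p : V := e ⟨0, h0⟩
  let q : V := e i
  have hpq : p ≠ q := fun h => by
    have := congrArg Fin.val (e.injective h)
    simp at this; omega
  have hp : hA.eigenvalues p = G.eigenvalue ⟨0, h0⟩ := by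
    simp [Matrix.IsHermitian.eigenvalues, eigenvalue, p, e]
  have hq : hA.eigenvalues q = G.eigenvalue i := by
    simp [Matrix.IsHermitian.eigenvalues, eigenvalue, q, e]
  have hl0 := le_eigenvalue_zero hG.1 h0
  rw [← hq]; rw [← hp] at hl0
  set lp := hA.eigenvalues p
  set lq := hA.eigenvalues q
  let b := hA.eigenvectorBasis
  set σp := ∑ v, b p v
  set σq := ∑ v, b q v
  set c := (d : ℝ) ^ 2 - γ ^ 2 / (2 * d ^ 2)
  have hcd : c ≤ (d : ℝ) ^ 2 := by
    have : 0 ≤ γ ^ 2 / (2 * (d : ℝ) ^ 2) := by positivity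
    simp only [c]; linarith
  have hc : lq ^ 2 ≤ c := by
    have hnorm : ∀ r, ∑ v, b r v ^ 2 = 1 := fun r => by
      have := b.orthonormal.1 r
      rw [EuclideanSpace.norm_eq, Real.sqrt_eq_one] at this
      simpa using this
    have horth : ∑ v, b p v * b q v = 0 := by
      have := b.orthonormal.2 hpq
      simpa [PiLp.inner_apply, mul_comm] using this
    have hmul : ∀ r v, G.adj.mulVec (b r) v = hA.eigenvalues r * b r v := fun r v => by
      have := congrFun (hA.mulVec_eigenvectorBasis r) v
      simpa using this
    have hcomb : ∀ α β : ℝ, ∑ v, (α * b p v + β * b q v) ^ 2 = α ^ 2 + β ^ 2 := fun α β => by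
      have : ∑ v, (α * b p v + β * b q v) ^ 2 = α ^ 2 * ∑ v, b p v ^ 2 + β ^ 2 * ∑ v, b q v ^ 2
          + 2 * α * β * ∑ v, b p v * b q v := by
        simp only [Finset.mul_sum, ← Finset.sum_add_distrib]
        exact Finset.sum_congr rfl fun v _ => by ring
      rw [this, hnorm, hnorm, horth]; ring
    have hmain : ∀ α β : ℝ, α * σp + β * σq = 0 →
        (α * lp) ^ 2 + (β * lq) ^ 2 ≤ c * (α ^ 2 + β ^ 2) := fun α β h => by
      have := sum_sq_adj_mulVec_le hd hγ hG (fun v => α * b p v + β * b q v) (by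
        rw [Finset.sum_add_distrib, ← Finset.mul_sum, ← Finset.mul_sum]; exact h)
      rw [hcomb] at this
      rw [← hcomb]
      convert! this using 3 with v
      have e1 : (fun v => α * b p v + β * b q v) = α • (b p : V → ℝ) + β • (b q : V → ℝ) := by
        ext; simp
      rw [e1, Matrix.mulVec_add, Matrix.mulVec_smul, Matrix.mulVec_smul]
      simp only [Pi.add_apply, Pi.smul_apply, hmul, smul_eq_mul]
      ring
    by_cases hσ : σq = 0
    · have := hmain 0 1 (by rw [hσ]; ring)
      simpa using this
    · have := hmain σq (-σp) (by ring)
      have h2 : 0 < σq ^ 2 := by positivity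
      have h3 : (d : ℝ) ^ 2 ≤ lp ^ 2 := by gcongr
      by_contra hcon
      push Not at hcon
      have hcl : c < lp ^ 2 := by
        have : 0 < γ ^ 2 / (2 * (d : ℝ) ^ 2) := by positivity
        simp only [c]; linarith
      nlinarith [mul_pos h2 (sub_pos.2 hcl), mul_nonneg (sq_nonneg σp) (sub_pos.2 hcon).le]
  have hε : γ ^ 2 / (4 * (d : ℝ) ^ 3) ≤ d := by
    rw [div_le_iff₀ (by positivity)]
    have : (1 : ℝ) ≤ d ^ 4 := one_le_pow₀ hd1
    nlinarith
  refine abs_le_of_sq_le_sq ?_ (by linarith)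
  -- The gap is chosen so that twice its product with `d` is `γ ^ 2 / (2 * d ^ 2)`, the loss in `c`.
  have : ((d : ℝ) - γ ^ 2 / (4 * d ^ 3)) ^ 2 = c + (γ ^ 2 / (4 * d ^ 3)) ^ 2 := by
    simp only [c]; field_simp; ring
  rw [this]
  nlinarith [sq_nonneg (γ ^ 2 / (4 * (d : ℝ) ^ 3))]

end LoopGraph

/-! ### Estimates for binomial coefficients. -/

theorem Nat.pow_le_pow_mul_choose {n s : ℕ} (h : s ≤ n) : n ^ s ≤ s ^ s * n.choose s := by
  have h1 : n ^ s * s.factorial ≤ s ^ s * n.choose s * s.factorial := by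
    calc n ^ s * s.factorial = ∏ i ∈ Finset.range s, n * (s - i) := by
          rw [Finset.prod_mul_distrib, Finset.prod_const, Finset.card_range,
            ← Nat.descFactorial_eq_prod_range, Nat.descFactorial_self]
      _ ≤ ∏ i ∈ Finset.range s, s * (n - i) := by
          refine Finset.prod_le_prod' fun i _ => ?_
          rw [Nat.mul_sub, Nat.mul_sub, mul_comm n s]
          exact Nat.sub_le_sub_left (Nat.mul_le_mul_right i h) _
      _ = s ^ s * n.choose s * s.factorial := by
          rw [Finset.prod_mul_distrib, Finset.prod_const, Finset.card_range,
            ← Nat.descFactorial_eq_prod_range, Nat.descFactorial_eq_factorial_mul_choose]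
          ring
  exact Nat.le_of_mul_le_mul_right h1 (Nat.factorial_pos s)

theorem Nat.choose_le_choose_right_of_le_half {n a b : ℕ} (hab : a ≤ b) (hb : 2 * b ≤ n) :
    n.choose a ≤ n.choose b := by
  induction b, hab using Nat.le_induction with
  | base => exact le_rfl
  | succ b hab ih =>
    exact (ih (by omega)).trans (Nat.choose_le_succ_of_lt_half_left (by omega))

/-- Binomial coefficients grow exponentially in the lower entry. -/
theorem Nat.choose_pow_twelve_le {n s r : ℕ} (hs : 0 < s) (hsn : 2 * s ≤ n) (hr : 576 * r ≤ s) :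
    n.choose r ^ 12 ≤ n.choose s := by
  have hs0 : (0 : ℝ) < s := by exact_mod_cast hs
  set q : ℝ := n / s with hq
  have hq2 : 2 ≤ q := by
    rw [hq, le_div_iff₀ hs0]; exact_mod_cast hsn
  -- Write `n = q * 64 * (s / 64)` in `n ^ r / r!` and bound the last factor by the exponential
  -- series.
  have h1 : (n.choose r : ℝ) ≤ q ^ r * 64 ^ r * Real.exp (s / 64) := by
    have e1 : ((s : ℝ) / 64) ^ r / r.factorial ≤ Real.exp (s / 64) :=
      Real.pow_div_factorial_le_exp _ (by positivity) r
    calc (n.choose r : ℝ) ≤ (n : ℝ) ^ r / r.factorial := Nat.choose_le_pow_div r n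
      _ = q ^ r * 64 ^ r * (((s : ℝ) / 64) ^ r / r.factorial) := by
          rw [← mul_div_assoc, ← mul_pow, ← mul_pow]
          congr 2
          rw [hq]; field_simp
      _ ≤ _ := mul_le_mul_of_nonneg_left e1 (by positivity)
  have h2 : q ^ s ≤ n.choose s := by
    rw [hq, div_pow, div_le_iff₀ (by positivity), mul_comm]
    exact_mod_cast Nat.pow_le_pow_mul_choose (by omega : s ≤ n)
  have hexp : Real.exp (s / 64) ^ 96 ≤ (2 : ℝ) ^ (3 * s) := by
    rw [← Real.exp_nat_mul, pow_mul]
    have e2 : Real.exp (3 / 2) ≤ 2 ^ 3 := by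
      have := Real.exp_one_lt_d9
      have h3 : Real.exp (3 / 2) ≤ Real.exp (1 + 1) := Real.exp_le_exp.2 (by norm_num)
      rw [Real.exp_add] at h3
      nlinarith [Real.exp_pos 1]
    calc Real.exp (((96 : ℕ) : ℝ) * (s / 64)) = Real.exp (3 / 2) ^ s := by
          rw [← Real.exp_nat_mul]; congr 1; push_cast; ring
      _ ≤ _ := pow_le_pow_left₀ (Real.exp_pos _).le e2 s
  -- All bases are replaced by `q ≥ 2`. The exponent `672 * r + 3 * s` is below `8 * s`, and `96 =
  -- 12 * 8`.
  have h3 : (n.choose r : ℝ) ^ 96 ≤ q ^ (8 * s) := by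
    calc (n.choose r : ℝ) ^ 96 ≤ (q ^ r * 64 ^ r * Real.exp (s / 64)) ^ 96 :=
          pow_le_pow_left₀ (Nat.cast_nonneg _) h1 96
      _ = q ^ (96 * r) * 2 ^ (576 * r) * Real.exp (s / 64) ^ 96 := by
          rw [mul_pow, mul_pow, ← pow_mul, ← pow_mul, mul_comm r 96,
            show (64 : ℝ) = 2 ^ 6 by norm_num, ← pow_mul]
          congr 3; ring
      _ ≤ q ^ (96 * r) * q ^ (576 * r) * q ^ (3 * s) := by gcongr; exact hexp.trans (by gcongr)
      _ = q ^ (96 * r + 576 * r + 3 * s) := by rw [pow_add, pow_add]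
      _ ≤ q ^ (8 * s) := pow_le_pow_right₀ (by linarith) (by omega)
  have h4 : ((n.choose r : ℝ) ^ 12) ^ 8 ≤ (n.choose s : ℝ) ^ 8 := by
    calc ((n.choose r : ℝ) ^ 12) ^ 8 = (n.choose r : ℝ) ^ 96 := by rw [← pow_mul]
      _ ≤ q ^ (8 * s) := h3
      _ = (q ^ s) ^ 8 := by rw [← pow_mul, mul_comm]
      _ ≤ _ := pow_le_pow_left₀ (by positivity) h2 8
  exact_mod_cast le_of_pow_le_pow_left₀ (by norm_num) (Nat.cast_nonneg _) h4

/-- `C(n, 4D)` is at least `(n / 4D)^(4D)`, and `n ≥ (4D)²` means `n / 4D ≥ √n`. -/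
theorem Nat.pow_le_choose_of_sq_le {D n s : ℕ} (hs : 4 * D ≤ s) (hsn : 2 * s ≤ n)
    (hn : (4 * D) ^ 2 ≤ n) : n ^ (2 * D) ≤ n.choose s := by
  refine le_trans ?_ (Nat.choose_le_choose_right_of_le_half hs hsn)
  rcases Nat.eq_zero_or_pos D with h0 | h0
  · simp [h0]
  have h1 := Nat.pow_le_pow_mul_choose (by omega : 4 * D ≤ n)
  have h2 : (4 * D) ^ (4 * D) * n ^ (2 * D) ≤ n ^ (4 * D) := by
    calc (4 * D) ^ (4 * D) * n ^ (2 * D) = ((4 * D) ^ 2 * n) ^ (2 * D) := by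
          rw [mul_pow ((4 * D) ^ 2), ← pow_mul, ← mul_assoc 2, show 2 * 2 = 4 from rfl]
      _ ≤ (n * n) ^ (2 * D) := Nat.pow_le_pow_left (Nat.mul_le_mul_right n hn) _
      _ = n ^ (4 * D) := by rw [← pow_two, ← pow_mul]; congr 1; ring
  exact Nat.le_of_mul_le_mul_left (h2.trans h1) (by positivity)

theorem Nat.pow_mul_choose_pow_six_le {D n s r : ℕ} (hs0 : 0 < s) (hs : 4 * D ≤ s)
    (hsn : 2 * s ≤ n) (hn : (4 * D) ^ 2 ≤ n) (hr : 576 * r ≤ s) :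
    n ^ D * n.choose r ^ 6 ≤ n.choose s := by
  have h1 := Nat.pow_le_choose_of_sq_le hs hsn hn
  have h2 := Nat.choose_pow_twelve_le hs0 hsn hr
  refine (Nat.pow_le_pow_iff_left two_ne_zero).1 ?_
  calc (n ^ D * n.choose r ^ 6) ^ 2 = n ^ (2 * D) * n.choose r ^ 12 := by
        rw [mul_pow, ← pow_mul, ← pow_mul, mul_comm D 2]
    _ ≤ n.choose s * n.choose s := Nat.mul_le_mul h1 h2
    _ = _ := (pow_two _).symm

/-! ### Permutations that join two sets, and the union bound over pairs. -/

section Perm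

open scoped Pointwise
open Equiv

variable {V : Type} [Fintype V] [DecidableEq V]

/-- The permutations `π` such that `π` and its inverse map `A` into `B`. -/
def joiningPerms (A B : Finset V) : Finset (Perm V) :=
  Finset.univ.filter fun π => π • A ⊆ B ∧ A ⊆ π • B

/-- The pairs of sets that are equivalent to `(A, B)` under permutations. -/
def similarPairs (A B : Finset V) : Finset (Finset V × Finset V) :=
  Finset.univ.filter fun t =>
    t.1.card = A.card ∧ t.2.card = B.card ∧ (t.1 ∩ t.2).card = (A ∩ B).card

theorem mem_similarPairs {A B : Finset V} {t : Finset V × Finset V} : t ∈ similarPairs A B ↔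
    t.1.card = A.card ∧ t.2.card = B.card ∧ (t.1 ∩ t.2).card = (A ∩ B).card := by
  simp [similarPairs]

/-- The three cardinalities determine the sizes of the four cells cut out by two sets, and cells of
equal size can be matched bijectively. Hence `similarPairs` is an orbit of the symmetric group. -/
theorem exists_perm_smul_pair {A B A' B' : Finset V} (h1 : A'.card = A.card)
    (h2 : B'.card = B.card) (h3 : (A' ∩ B').card = (A ∩ B).card) :
    ∃ π : Perm V, π • A = A' ∧ π • B = B' := by
  let f : Finset V → Finset V → V → Bool × Bool := fun X Y v => (decide (v ∈ X), decide (v ∈ Y))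
  have hcard : ∀ X Y : Finset V, ∀ c, Fintype.card {v // f X Y v = c} =
      match c with
      | (true, true) => (X ∩ Y).card
      | (true, false) => X.card - (X ∩ Y).card
      | (false, true) => Y.card - (X ∩ Y).card
      | (false, false) => Fintype.card V - (X.card + Y.card - (X ∩ Y).card) := by
    rintro X Y ⟨_ | _, _ | _⟩ <;> rw [Fintype.card_subtype]
    · simp only []
      rw [← Finset.card_union, ← Finset.card_compl]
      congr 1; ext v; simp [f]
    · simp only []
      rw [← Finset.card_sdiff]
      congr 1; ext v; simp [f, and_comm]
    · simp only []
      rw [Finset.inter_comm, ← Finset.card_sdiff]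
      congr 1; ext v; simp [f]
    · simp only []
      congr 1; ext v; simp [f]
  have e : ∀ c, {v // f A B v = c} ≃ {v // f A' B' v = c} := fun c =>
    Fintype.equivOfCardEq (by rw [hcard, hcard, h1, h2, h3])
  let π : Perm V := Equiv.ofFiberEquiv e
  have hπ : ∀ v, f A' B' (π v) = f A B v := fun v => Equiv.ofFiberEquiv_map e v
  have hA : ∀ v, π v ∈ A' ↔ v ∈ A := fun v => by
    have := congrArg Prod.fst (hπ v)
    simpa [f] using this
  have hB : ∀ v, π v ∈ B' ↔ v ∈ B := fun v => by
    have := congrArg Prod.snd (hπ v)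
    simpa [f] using this
  refine ⟨π, ?_, ?_⟩
  · ext v
    rw [← Finset.inv_smul_mem_iff, ← hA]; simp [Perm.smul_def]
  · ext v
    rw [← Finset.inv_smul_mem_iff, ← hB]; simp [Perm.smul_def]

/-- A joining `π` sends `(A, B)` to a pair `(X, Y)` of its orbit with `X ⊆ B` and `A ⊆ Y`. The
binomials count these pairs, and each is reached by `n!` divided by the orbit size many
permutations. -/
theorem card_joiningPerms_mul_le {A B : Finset V} (hAB : A.card ≤ B.card) :
    (joiningPerms A B).card * (similarPairs A B).card ≤
      (Fintype.card V).choose (B.card - A.card) ^ 2 * (Fintype.card V).factorial := by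
  have hex : ∀ t : Finset V × Finset V, ∃ π : Perm V,
      t ∈ similarPairs A B → π • A = t.1 ∧ π • B = t.2 := fun t => by
    by_cases ht : t ∈ similarPairs A B
    · obtain ⟨a, b, c⟩ := mem_similarPairs.1 ht
      obtain ⟨π, hπ⟩ := exists_perm_smul_pair a b c
      exact ⟨π, fun _ => hπ⟩
    · exact ⟨1, fun h => absurd h ht⟩
  choose τ hτ using hex
  have hsim : ∀ π : Perm V, (π • A, π • B) ∈ similarPairs A B := fun π =>
    mem_similarPairs.2 ⟨by simp, by simp, by
      rw [← Finset.smul_finset_inter]; simp⟩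
  let 𝒳 := B.powersetCard A.card
  let 𝒴 := (Finset.univ : Finset V).powersetCard (B.card - A.card)
  have h1 : (joiningPerms A B ×ˢ similarPairs A B).card ≤
      ((𝒳 ×ˢ 𝒴) ×ˢ (Finset.univ : Finset (Perm V))).card := by
    -- Orbit-stabilizer as an injection. The last component carries `(A, B)` to `t`, so it reveals
    -- `t`; the first two reveal the image pair, after which `π` is found by cancellation.
    refine Finset.card_le_card_of_injOn (fun x => ((x.1 • A, (x.1 • B) \ A),
      τ x.2 * (τ (x.1 • A, x.1 • B))⁻¹ * x.1)) ?_ ?_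
    · rintro ⟨π, t⟩ h
      simp only [Finset.coe_product, Set.mem_prod, Finset.mem_coe, joiningPerms,
        Finset.mem_filter, Finset.mem_univ, true_and] at h
      simp only [Finset.coe_product, Set.mem_prod, Finset.mem_coe, 𝒳, 𝒴, Finset.mem_powersetCard,
        Finset.mem_univ, and_true]
      refine ⟨⟨h.1.1, by simp⟩, Finset.subset_univ _, ?_⟩
      rw [Finset.card_sdiff_of_subset h.1.2]; simp
    · rintro ⟨π, t⟩ h ⟨π', t'⟩ h' heq
      simp only [Finset.coe_product, Set.mem_prod, Finset.mem_coe, joiningPerms,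
        Finset.mem_filter, Finset.mem_univ, true_and] at h h'
      simp only [Prod.mk.injEq] at heq
      obtain ⟨⟨ha, hb⟩, hc⟩ := heq
      have hb' : π • B = π' • B := by
        rw [← Finset.sdiff_union_of_subset h.1.2, ← Finset.sdiff_union_of_subset h'.1.2, hb]
      have hst : ∀ (π : Perm V) (t), t ∈ similarPairs A B →
          (τ t * (τ (π • A, π • B))⁻¹ * π) • A = t.1 ∧
          (τ t * (τ (π • A, π • B))⁻¹ * π) • B = t.2 := fun π t ht => by
        have hτ1 := hτ _ (hsim π)
        constructor
        · rw [mul_smul, mul_smul, inv_smul_eq_iff.2 hτ1.1.symm, (hτ _ ht).1]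
        · rw [mul_smul, mul_smul, inv_smul_eq_iff.2 hτ1.2.symm, (hτ _ ht).2]
      have htt : t = t' := Prod.ext
        (by rw [← (hst π t h.2).1, ← (hst π' t' h'.2).1, hc])
        (by rw [← (hst π t h.2).2, ← (hst π' t' h'.2).2, hc])
      subst htt
      rw [ha, hb'] at hc
      exact Prod.ext (mul_left_cancel hc) rfl
  simp only [Finset.card_product, 𝒳, 𝒴, Finset.card_powersetCard, Finset.card_univ,
    Fintype.card_perm] at h1
  refine h1.trans (Nat.mul_le_mul_right _ ?_)
  rw [pow_two]
  refine Nat.mul_le_mul_right _ ?_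
  rw [← Nat.choose_symm hAB]
  exact Nat.choose_le_choose _ (Finset.card_le_univ B)

/-- The first members of the pairs in the orbit are all the sets of size `|A|`. -/
theorem choose_le_card_similarPairs (A B : Finset V) :
    (Fintype.card V).choose A.card ≤ (similarPairs A B).card := by
  rw [← Finset.card_univ, ← Finset.card_powersetCard]
  have hex : ∀ A' : Finset V, ∃ B', A'.card = A.card → (A', B') ∈ similarPairs A B := fun A' => by
    by_cases h : A'.card = A.card
    · obtain ⟨π, hπ, -⟩ := exists_perm_smul_pair (A := A) (B := A) (A' := A') (B' := A') h h (by simp [h])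
      refine ⟨π • B, fun _ => mem_similarPairs.2 ⟨h, by simp, ?_⟩⟩
      simp only [← hπ]
      rw [← Finset.smul_finset_inter]; simp
    · exact ⟨∅, fun h' => absurd h' h⟩
  choose F hF using hex
  refine Finset.card_le_card_of_injOn (fun A' => (A', F A')) ?_ ?_
  · intro A' h
    exact hF A' (Finset.mem_powersetCard.1 h).2
  · intro A' _ A'' _ h
    exact congrArg Prod.fst h

/-- The pairs with a given intersection size form a single orbit or none, so their reciprocals sum
to at most `1`; there are at most `n + 1` intersection sizes. -/
theorem sum_inv_card_similarPairs_le (s t : ℕ) :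
    ∑ p ∈ Finset.univ.filter (fun p : Finset V × Finset V => p.1.card = s ∧ p.2.card = t),
      ((similarPairs p.1 p.2).card : ℝ)⁻¹ ≤ Fintype.card V + 1 := by
  rw [← Finset.sum_fiberwise_of_maps_to (t := Finset.range (Fintype.card V + 1))
    (g := fun p => (p.1 ∩ p.2).card)
    (fun p _ => Finset.mem_range.2 (Nat.lt_succ_of_le (Finset.card_le_univ _)))]
  refine (Finset.sum_le_sum (g := fun _ => (1 : ℝ)) fun c _ => ?_).trans (by simp)
  rcases Finset.eq_empty_or_nonempty ((Finset.univ.filter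
    (fun p : Finset V × Finset V => p.1.card = s ∧ p.2.card = t)).filter
      fun p => (p.1 ∩ p.2).card = c) with he | ⟨q, hq⟩
  · rw [he]; simp
  simp only [Finset.mem_filter, Finset.mem_univ, true_and] at hq
  have hS : ∀ p ∈ ((Finset.univ.filter
    (fun p : Finset V × Finset V => p.1.card = s ∧ p.2.card = t)).filter
      fun p => (p.1 ∩ p.2).card = c), similarPairs p.1 p.2 = similarPairs q.1 q.2 := by
    intro p hp
    simp only [Finset.mem_filter, Finset.mem_univ, true_and] at hp
    simp [similarPairs, hp, hq]
  rw [Finset.sum_congr rfl fun p hp => by rw [hS p hp], Finset.sum_const]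
  have : ((Finset.univ.filter
    (fun p : Finset V × Finset V => p.1.card = s ∧ p.2.card = t)).filter
      fun p => (p.1 ∩ p.2).card = c) = similarPairs q.1 q.2 := by
    ext p
    simp [similarPairs, hq, and_assoc]
  rw [this, nsmul_eq_mul]
  exact mul_inv_le_one

/-- A union bound over all pairs of sets of given sizes. -/
theorem sum_pairs_le {D s r : ℕ} (hs0 : 0 < s) (hs : 4 * (2 * D + 3) ≤ s)
    (hsn : 2 * s ≤ Fintype.card V) (hn : (4 * (2 * D + 3)) ^ 2 ≤ Fintype.card V)
    (hr : 576 * r ≤ s) (P : Finset V → Finset V → ℝ)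
    (hP : ∀ A B : Finset V, A.card = s → B.card = s + r →
      P A B ^ 2 ≤ (Fintype.card V * (joiningPerms A B).card / (Fintype.card V).factorial) ^ 3) :
    (Fintype.card V : ℝ) ^ D * ∑ p ∈ Finset.univ.filter
      (fun p : Finset V × Finset V => p.1.card = s ∧ p.2.card = s + r), P p.1 p.2 ≤
      Fintype.card V + 1 := by
  rw [Finset.mul_sum]
  refine le_trans (Finset.sum_le_sum fun p hp => ?_) (sum_inv_card_similarPairs_le s (s + r))
  obtain ⟨A, B⟩ := p
  simp only [Finset.mem_filter, Finset.mem_univ, true_and] at hp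
  obtain ⟨hA, hB⟩ := hp
  simp only
  set n := Fintype.card V
  set N := (similarPairs A B).card with hN
  set g := (joiningPerms A B).card
  have hCN : n.choose s ≤ N := hA ▸ choose_le_card_similarPairs A B
  have hN0 : 0 < N := lt_of_lt_of_le (Nat.choose_pos (by omega)) hCN
  have hn0 : 0 < n := by omega
  have h1 : g * N ≤ n.choose r ^ 2 * n.factorial := by
    have := card_joiningPerms_mul_le (A := A) (B := B) (by omega)
    rwa [hB, hA, Nat.add_sub_cancel_left] at this
  have h2 : n ^ (2 * D + 3) * n.choose r ^ 6 ≤ N :=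
    (Nat.pow_mul_choose_pow_six_le hs0 hs hsn hn hr).trans hCN
  have hNr : (0 : ℝ) < N := by exact_mod_cast hN0
  have hf : (0 : ℝ) < n.factorial := by exact_mod_cast n.factorial_pos
  have h3 : (n : ℝ) * g / n.factorial ≤ n * n.choose r ^ 2 / N := by
    rw [div_le_div_iff₀ hf hNr, mul_assoc, mul_assoc]
    exact mul_le_mul_of_nonneg_left (by exact_mod_cast h1) (Nat.cast_nonneg _)
  -- The exponent `3/2` leaves a spare `N^(-1/2)`, which after squaring absorbs `n ^ (2 * D + 3) *
  -- C(n,r) ^ 6`.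
  have h4 : ((n : ℝ) ^ D * P A B) ^ 2 ≤ ((N : ℝ)⁻¹) ^ 2 := by
    calc ((n : ℝ) ^ D * P A B) ^ 2 = (n : ℝ) ^ (2 * D) * P A B ^ 2 := by
          rw [mul_pow, ← pow_mul, mul_comm D 2]
      _ ≤ (n : ℝ) ^ (2 * D) * (n * n.choose r ^ 2 / N) ^ 3 :=
          mul_le_mul_of_nonneg_left ((hP A B hA hB).trans
            (pow_le_pow_left₀ (by positivity) h3 3)) (by positivity)
      _ = ((n : ℝ) ^ (2 * D + 3) * n.choose r ^ 6) / N ^ 3 := by ring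
      _ ≤ N / N ^ 3 := by
          gcongr
          exact_mod_cast h2
      _ = ((N : ℝ)⁻¹) ^ 2 := by field_simp
  exact le_of_sq_le_sq h4 (by positivity)

end Perm

/-! ### Matchings, and the weaving of two matchings into a permutation. -/

section Perm

open scoped Pointwise
open Equiv

variable {V : Type} [Fintype V] [DecidableEq V]

/-- Perfect matchings, as involutions without fixed points, that map `A` into `B`. -/
def joiningMatchings (A B : Finset V) : Finset (Perm V) :=
  Finset.univ.filter fun σ => (∀ x, σ (σ x) = x) ∧ (∀ x, σ x ≠ x) ∧ σ • A ⊆ B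

open Classical in
/-- Near perfect matchings, as involutions with one fixed point, that map `A` into `B`. -/
noncomputable def joiningNearMatchings (A B : Finset V) : Finset (Perm V) :=
  Finset.univ.filter fun σ => (∀ x, σ (σ x) = x) ∧ (∃! x, σ x = x) ∧ σ • A ⊆ B

theorem mem_joiningMatchings {A B : Finset V} {σ : Perm V} : σ ∈ joiningMatchings A B ↔
    (∀ x, σ (σ x) = x) ∧ (∀ x, σ x ≠ x) ∧ σ • A ⊆ B := by
  simp [joiningMatchings]

theorem mem_joiningNearMatchings {A B : Finset V} {σ : Perm V} : σ ∈ joiningNearMatchings A B ↔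
    (∀ x, σ (σ x) = x) ∧ (∃! x, σ x = x) ∧ σ • A ⊆ B := by
  simp [joiningNearMatchings]

omit [Fintype V] in
theorem smul_finset_subset_iff_forall {π : Perm V} {A B : Finset V} :
    π • A ⊆ B ↔ ∀ x ∈ A, π x ∈ B := by
  simp [Finset.subset_iff, Finset.mem_smul_finset]

omit [Fintype V] in
theorem subset_smul_finset_iff_forall {π : Perm V} {A B : Finset V} :
    A ⊆ π • B ↔ ∀ x ∈ A, π⁻¹ x ∈ B := by
  simp [Finset.subset_iff, ← Finset.inv_smul_mem_iff]

omit [DecidableEq V] in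
theorem sameCycle_of_forall_sameCycle {f g : Perm V} (h : ∀ x, f.SameCycle x (g x)) {x y : V}
    (hxy : g.SameCycle x y) : f.SameCycle x y := by
  obtain ⟨k, rfl⟩ := hxy.exists_nat_pow_eq
  clear hxy
  induction k with
  | zero => exact Perm.SameCycle.refl _ _
  | succ k ih =>
    rw [pow_succ', Perm.mul_apply]
    exact ih.trans (h _)

omit [Fintype V] [DecidableEq V] in
/-- In the union of two perfect matchings the two ends of an edge belong to different cycles of the
composition. -/
theorem not_sameCycle_mul_of_involutive {σ σ' : Perm V} (h : ∀ x, σ (σ x) = x)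
    (h' : ∀ x, σ' (σ' x) = x) (hf : ∀ x, σ x ≠ x) (hf' : ∀ x, σ' x ≠ x) (x : V) :
    ¬ (σ' * σ).SameCycle x (σ x) := by
  rintro ⟨i, hi⟩
  set ρ := σ' * σ with hρ
  have hσσ : σ * σ = 1 := Perm.ext h
  have hσ : σ⁻¹ = σ := inv_eq_of_mul_eq_one_left hσσ
  have hσ' : σ'⁻¹ = σ' := inv_eq_of_mul_eq_one_left (Perm.ext h')
  -- Two involutions generate a dihedral group. If `σ x = ρ ^ i x`, then `σ` or `σ'`, according to
  -- the parity of `i`, fixes a point halfway along.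
  have hconj : σ * ρ * σ⁻¹ = ρ⁻¹ := by
    rw [hρ, mul_inv_rev, hσ', hσ, mul_assoc, mul_assoc, hσσ, mul_one]
  have hcomm : ∀ (k : ℤ) (y : V), σ ((ρ ^ k) y) = (ρ ^ (-k)) (σ y) := fun k y => by
    have : σ * ρ ^ k * σ⁻¹ = ρ ^ (-k) := by rw [← conj_zpow, hconj, inv_zpow, zpow_neg]
    rw [← this]; simp
  obtain ⟨l, rfl | rfl⟩ := Int.even_or_odd' i
  · refine hf ((ρ ^ l) x) ?_
    rw [hcomm, ← hi, ← Perm.mul_apply, ← zpow_add]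
    congr 2; ring
  · refine hf' ((ρ ^ (l + 1)) x) ?_
    have hs : ∀ y, σ' y = ρ (σ y) := fun y => by simp [hρ, h]
    rw [hs, hcomm, ← hi, ← Perm.mul_apply, ← Perm.mul_apply, ← zpow_one_add, ← zpow_add]
    congr 2; ring

section Weave

variable (ord : Set V → ℕ)

/-- The vertices at which the first of two matchings is followed when the cycles of their union are
oriented. -/
def forwardSet (ρ σ : Perm V) : Set V :=
  {x | ord {y | ρ.SameCycle x y} < ord {y | ρ.SameCycle (σ x) y}}

omit [Fintype V] [DecidableEq V] in
theorem setOf_sameCycle_eq {ρ : Perm V} {x y : V} (h : ρ.SameCycle x y) :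
    {z | ρ.SameCycle x z} = {z | ρ.SameCycle y z} :=
  Set.ext fun _ => ⟨fun hz => h.symm.trans hz, fun hz => h.trans hz⟩

variable {ord} {σ σ' : Perm V}

omit [Fintype V] [DecidableEq V] in
-- A cycle of the union of the matchings splits into two cycles of `σ' * σ`, exchanged by `σ`. The
-- injective labelling `ord` selects one of them, that is, an orientation.
theorem mem_forwardSet_first (hord : Function.Injective ord) (h : ∀ x, σ (σ x) = x)
    (h' : ∀ x, σ' (σ' x) = x) (hf : ∀ x, σ x ≠ x) (hf' : ∀ x, σ' x ≠ x) (x : V) :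
    σ x ∈ forwardSet ord (σ' * σ) σ ↔ x ∉ forwardSet ord (σ' * σ) σ := by
  have hne : ord {y | (σ' * σ).SameCycle x y} ≠ ord {y | (σ' * σ).SameCycle (σ x) y} := fun he =>
    not_sameCycle_mul_of_involutive h h' hf hf' x
      ((Set.ext_iff.1 (hord he) (σ x)).2 (Perm.SameCycle.refl _ _))
  simp only [forwardSet, Set.mem_ofPred_eq, h]
  omega

omit [Fintype V] [DecidableEq V] in
theorem mem_forwardSet_mul (h : ∀ x, σ (σ x) = x) (h' : ∀ x, σ' (σ' x) = x) (x : V) :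
    (σ' * σ) x ∈ forwardSet ord (σ' * σ) σ ↔ x ∈ forwardSet ord (σ' * σ) σ := by
  have h1 : (σ' * σ).SameCycle ((σ' * σ) x) x :=
    (Perm.sameCycle_apply_left).2 (Perm.SameCycle.refl _ _)
  have h2 : (σ' * σ).SameCycle (σ ((σ' * σ) x)) (σ x) := by
    refine Perm.sameCycle_apply_left.1 ?_
    simp only [Perm.mul_apply, h, h']
    exact Perm.SameCycle.refl _ _
  simp only [forwardSet, Set.mem_ofPred_eq, setOf_sameCycle_eq h1, setOf_sameCycle_eq h2]

omit [Fintype V] [DecidableEq V] in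
theorem mem_forwardSet_second (hord : Function.Injective ord) (h : ∀ x, σ (σ x) = x)
    (h' : ∀ x, σ' (σ' x) = x) (hf : ∀ x, σ x ≠ x) (hf' : ∀ x, σ' x ≠ x) (x : V) :
    σ' x ∈ forwardSet ord (σ' * σ) σ ↔ x ∉ forwardSet ord (σ' * σ) σ := by
  rw [← mem_forwardSet_first hord h h' hf hf', ← mem_forwardSet_mul h h' (σ x)]
  simp [h]

open Classical in
/-- The permutation that follows `σ` on the forward vertices and `σ'` on the others. -/
noncomputable def weave (hord : Function.Injective ord) (h : ∀ x, σ (σ x) = x)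
    (h' : ∀ x, σ' (σ' x) = x) (hf : ∀ x, σ x ≠ x) (hf' : ∀ x, σ' x ≠ x) : Perm V where
  toFun x := if x ∈ forwardSet ord (σ' * σ) σ then σ x else σ' x
  invFun x := if x ∈ forwardSet ord (σ' * σ) σ then σ' x else σ x
  left_inv x := by
    by_cases hx : x ∈ forwardSet ord (σ' * σ) σ
    · simp [hx, mem_forwardSet_first hord h h' hf hf', h]
    · simp [hx, mem_forwardSet_second hord h h' hf hf', h']
  right_inv x := by
    by_cases hx : x ∈ forwardSet ord (σ' * σ) σ
    · simp [hx, mem_forwardSet_second hord h h' hf hf', h']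
    · simp [hx, mem_forwardSet_first hord h h' hf hf', h]

variable (hord : Function.Injective ord) (h : ∀ x, σ (σ x) = x)
    (h' : ∀ x, σ' (σ' x) = x) (hf : ∀ x, σ x ≠ x) (hf' : ∀ x, σ' x ≠ x)

include hord h h' hf hf'

omit [Fintype V] [DecidableEq V] in
theorem weave_of_mem {x : V} (hx : x ∈ forwardSet ord (σ' * σ) σ) :
    weave hord h h' hf hf' x = σ x := if_pos hx

omit [Fintype V] [DecidableEq V] in
theorem weave_of_notMem {x : V} (hx : x ∉ forwardSet ord (σ' * σ) σ) :
    weave hord h h' hf hf' x = σ' x := if_neg hx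

omit [Fintype V] [DecidableEq V] in
theorem weave_inv_of_mem {x : V} (hx : x ∈ forwardSet ord (σ' * σ) σ) :
    (weave hord h h' hf hf')⁻¹ x = σ' x := if_pos hx

omit [Fintype V] [DecidableEq V] in
theorem weave_inv_of_notMem {x : V} (hx : x ∉ forwardSet ord (σ' * σ) σ) :
    (weave hord h h' hf hf')⁻¹ x = σ x := if_neg hx

omit [DecidableEq V] in
-- The square of the weave is `σ' * σ` at forward vertices and its inverse at the others. So the
-- weave alone determines the cycles of `σ' * σ`, the first step in recovering the two matchings.
theorem sameCycle_weave_sq_iff (x y : V) :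
    (weave hord h h' hf hf' ^ 2).SameCycle x y ↔ (σ' * σ).SameCycle x y := by
  set π := weave hord h h' hf hf' with hπ
  have h1 : ∀ x ∈ forwardSet ord (σ' * σ) σ, (π ^ 2) x = (σ' * σ) x := fun x hx => by
    rw [pow_two, Perm.mul_apply, hπ, weave_of_mem _ _ _ _ _ hx, weave_of_notMem, Perm.mul_apply]
    simpa [mem_forwardSet_first hord h h' hf hf'] using hx
  have h2 : ∀ x ∉ forwardSet ord (σ' * σ) σ, (π ^ 2) x = (σ' * σ)⁻¹ x := fun x hx => by
    rw [pow_two, Perm.mul_apply, hπ, weave_of_notMem _ _ _ _ _ hx, weave_of_mem,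
      Perm.eq_inv_iff_eq]
    · simp [h, h']
    · simpa [mem_forwardSet_second hord h h' hf hf'] using hx
  constructor
  · refine sameCycle_of_forall_sameCycle fun x => ?_
    by_cases hx : x ∈ forwardSet ord (σ' * σ) σ
    · rw [h1 x hx]
      exact Perm.sameCycle_apply_right.2 (Perm.SameCycle.refl _ _)
    · rw [h2 x hx]
      exact ⟨-1, by simp⟩
  · refine sameCycle_of_forall_sameCycle fun x => ?_
    by_cases hx : x ∈ forwardSet ord (σ' * σ) σ
    · rw [← h1 x hx]
      exact Perm.sameCycle_apply_right.2 (Perm.SameCycle.refl _ _)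
    · rw [← Perm.sameCycle_apply_right, h2 _ (by rwa [mem_forwardSet_mul h h']), ← Perm.mul_apply,
        inv_mul_cancel]
      exact Perm.SameCycle.refl _ _

omit [DecidableEq V] in
-- The right side mentions only the weave, which is what makes the encoding injective. At a vertex
-- that is not forward the weave takes `σ'` instead of `σ`, but `σ' x` lies in the same cycle of `σ'
-- * σ` as `σ x`.
theorem mem_forwardSet_iff_weave (x : V) : x ∈ forwardSet ord (σ' * σ) σ ↔
    ord {y | (weave hord h h' hf hf' ^ 2).SameCycle x y} <
      ord {y | (weave hord h h' hf hf' ^ 2).SameCycle (weave hord h h' hf hf' x) y} := by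
  simp only [sameCycle_weave_sq_iff]
  by_cases hx : x ∈ forwardSet ord (σ' * σ) σ
  · rw [weave_of_mem _ _ _ _ _ hx]; rfl
  · rw [weave_of_notMem _ _ _ _ _ hx]
    have h2 : (σ' * σ).SameCycle (σ' x) (σ x) := by
      refine Perm.sameCycle_apply_right.1 ?_
      simp only [Perm.mul_apply, h]
      exact Perm.SameCycle.refl _ _
    rw [setOf_sameCycle_eq h2]; rfl

end Weave

/-- Pairs of perfect matchings are encoded by permutations. -/
theorem card_joiningMatchings_sq_le (A B : Finset V) :
    (joiningMatchings A B).card ^ 2 ≤ (joiningPerms A B).card := by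
  classical
  obtain ⟨ord, hord⟩ : ∃ ord : Set V → ℕ, Function.Injective ord :=
    ⟨fun s => Fintype.equivFin (Set V) s, fun s t h =>
      (Fintype.equivFin (Set V)).injective (Fin.ext h)⟩
  have hmem : ∀ σ : Perm V, σ ∈ joiningMatchings A B ↔
      (∀ x, σ (σ x) = x) ∧ (∀ x, σ x ≠ x) ∧ ∀ x ∈ A, σ x ∈ B := fun σ => by
    rw [mem_joiningMatchings, smul_finset_subset_iff_forall]
  have hmemP : ∀ π : Perm V, π ∈ joiningPerms A B ↔
      (∀ x ∈ A, π x ∈ B) ∧ ∀ x ∈ A, π⁻¹ x ∈ B := fun π => by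
    simp only [joiningPerms, Finset.mem_filter, Finset.mem_univ, true_and,
      smul_finset_subset_iff_forall, subset_smul_finset_iff_forall]
  let F : {σ // σ ∈ joiningMatchings A B} × {σ // σ ∈ joiningMatchings A B} →
      {π // π ∈ joiningPerms A B} := fun p =>
    have h1 := (hmem p.1.1).1 p.1.2
    have h2 := (hmem p.2.1).1 p.2.2
    ⟨weave hord h1.1 h2.1 h1.2.1 h2.2.1, (hmemP _).2 ⟨fun x hx => by
      by_cases hT : x ∈ forwardSet ord (p.2.1 * p.1.1) p.1.1
      · rw [weave_of_mem _ _ _ _ _ hT]; exact h1.2.2 x hx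
      · rw [weave_of_notMem _ _ _ _ _ hT]; exact h2.2.2 x hx, fun x hx => by
      by_cases hT : x ∈ forwardSet ord (p.2.1 * p.1.1) p.1.1
      · rw [weave_inv_of_mem _ _ _ _ _ hT]; exact h2.2.2 x hx
      · rw [weave_inv_of_notMem _ _ _ _ _ hT]; exact h1.2.2 x hx⟩⟩
  have hF : Function.Injective F := by
    rintro ⟨⟨σ, hσ⟩, ⟨σ', hσ'⟩⟩ ⟨⟨τ, hτ⟩, ⟨τ', hτ'⟩⟩ he
    have hs1 := (hmem _).1 hσ
    have hs2 := (hmem _).1 hσ'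
    have ht1 := (hmem _).1 hτ
    have ht2 := (hmem _).1 hτ'
    have hw : weave hord hs1.1 hs2.1 hs1.2.1 hs2.2.1 = weave hord ht1.1 ht2.1 ht1.2.1 ht2.2.1 :=
      congrArg Subtype.val he
    have hT : ∀ x, x ∈ forwardSet ord (σ' * σ) σ ↔ x ∈ forwardSet ord (τ' * τ) τ := fun x => by
      rw [mem_forwardSet_iff_weave hord hs1.1 hs2.1 hs1.2.1 hs2.2.1,
        mem_forwardSet_iff_weave hord ht1.1 ht2.1 ht1.2.1 ht2.2.1, hw]
    have e1 : σ = τ := Perm.ext fun x => by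
      by_cases hx : x ∈ forwardSet ord (σ' * σ) σ
      · rw [← weave_of_mem hord hs1.1 hs2.1 hs1.2.1 hs2.2.1 hx, hw,
          weave_of_mem _ _ _ _ _ ((hT x).1 hx)]
      · rw [← weave_inv_of_notMem hord hs1.1 hs2.1 hs1.2.1 hs2.2.1 hx, hw,
          weave_inv_of_notMem _ _ _ _ _ (mt (hT x).2 hx)]
    have e2 : σ' = τ' := Perm.ext fun x => by
      by_cases hx : x ∈ forwardSet ord (σ' * σ) σ
      · rw [← weave_inv_of_mem hord hs1.1 hs2.1 hs1.2.1 hs2.2.1 hx, hw,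
          weave_inv_of_mem _ _ _ _ _ ((hT x).1 hx)]
      · rw [← weave_of_notMem hord hs1.1 hs2.1 hs1.2.1 hs2.2.1 hx, hw,
          weave_of_notMem _ _ _ _ _ (mt (hT x).2 hx)]
    subst e1 e2
    rfl
  have := Fintype.card_le_of_injective F hF
  rwa [Fintype.card_prod, Fintype.card_coe, Fintype.card_coe, ← pow_two] at this

/-- A near perfect matching becomes a perfect matching when a vertex is added. -/
theorem card_joiningNearMatchings_le (A B : Finset V) :
    (joiningNearMatchings A B).card ≤
      (joiningMatchings (A.map Function.Embedding.some) (Finset.insertNone B)).card := by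
  classical
  have hmem : ∀ σ : Perm V, σ ∈ joiningNearMatchings A B ↔
      (∀ x, σ (σ x) = x) ∧ (∃! x, σ x = x) ∧ ∀ x ∈ A, σ x ∈ B := fun σ => by
    rw [mem_joiningNearMatchings, smul_finset_subset_iff_forall]
  have hex : ∀ σ : Perm V, ∃ o : Option V,
      σ ∈ joiningNearMatchings A B → ∃ p, o = some p ∧ ∀ x, σ x = x ↔ x = p := fun σ => by
    by_cases h : σ ∈ joiningNearMatchings A B
    · obtain ⟨-, ⟨p, hp, hp'⟩, -⟩ := (hmem σ).1 h
      exact ⟨some p, fun _ => ⟨p, rfl, fun x => ⟨hp' x, fun hx => hx ▸ hp⟩⟩⟩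
    · exact ⟨none, fun h' => absurd h' h⟩
  choose o ho using hex
  -- The new vertex `none` is matched with the unmatched vertex. As the latter may lie in `A`, the
  -- target set has to contain `none`.
  refine Finset.card_le_card_of_injOn (fun σ => Perm.decomposeOption.symm (o σ, σ)) ?_ ?_
  · intro σ hσ
    obtain ⟨p, hop, hp⟩ := ho σ hσ
    obtain ⟨h1, -, h3⟩ := (hmem σ).1 hσ
    have hpp : σ p = p := (hp p).2 rfl
    have hσp : ∀ x, σ x = p ↔ x = p := fun x =>
      ⟨fun h => by rw [← h1 x, h, hpp], fun h => h ▸ hpp⟩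
    have hnone : Perm.decomposeOption.symm (some p, σ) none = some p := by simp
    have hsome : ∀ x, Perm.decomposeOption.symm (some p, σ) (some x) =
        if x = p then none else some (σ x) := fun x => by
      simp only [Perm.decomposeOption_symm_apply, Perm.mul_apply, Equiv.optionCongr_apply,
        Option.map_some]
      by_cases hx : x = p
      · simp [hx, hpp]
      · rw [if_neg hx, swap_apply_of_ne_of_ne (by simp)]
        simpa [hσp] using hx
    simp only [joiningMatchings, Finset.coe_filter, Finset.mem_univ, true_and, Set.mem_ofPred_eq,
      smul_finset_subset_iff_forall, hop]
    refine ⟨?_, ?_, ?_⟩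
    · rintro (_ | x)
      · rw [hnone, hsome, if_pos rfl]
      · by_cases hx : x = p
        · rw [hsome, if_pos hx, hnone, hx]
        · rw [hsome, if_neg hx, hsome, if_neg (mt (hσp x).1 hx), h1]
    · rintro (_ | x)
      · rw [hnone]; simp
      · rw [hsome]
        by_cases hx : x = p
        · simp [hx]
        · simp [hx, hp]
    · intro y hy
      obtain ⟨x, hx, rfl⟩ := Finset.mem_map.1 hy
      rw [Function.Embedding.some_apply, hsome]
      by_cases hxp : x = p
      · simp [hxp]
      · simpa [hxp] using h3 x hx
  · intro σ _ τ _ h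
    exact congrArg Prod.snd (Perm.decomposeOption.symm.injective h)

/-- Sets that are invariant under a matching with at most one unmatched vertex. -/
theorem card_invariant_le {σ : Perm V} (h : ∀ x, σ (σ x) = x)
    (hfix : ∀ x y, σ x = x → σ y = y → x = y) (u : ℕ) :
    (Finset.univ.filter fun U : Finset V => U.card = u ∧ σ • U = U).card ≤
      (Fintype.card V).choose (u / 2) := by
  let e := Fintype.equivFin V
  -- An invariant set consists of matched pairs and possibly the unmatched vertex. It is determined
  -- by the lower ends of its pairs, since the parity of its size decides about the unmatched
  -- vertex.
  let T : Finset V → Finset V := fun U => U.filter fun x => e x < e (σ x)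
  let Φ : Finset V → Finset V := fun U => U.filter fun x => σ x = x
  have hΦ : ∀ U, (Φ U).card ≤ 1 := fun U => Finset.card_le_one.2 fun x hx y hy =>
    hfix x y (Finset.mem_filter.1 hx).2 (Finset.mem_filter.1 hy).2
  have hdec : ∀ U : Finset V, σ • U = U → U = (T U ∪ σ • T U) ∪ Φ U ∧
      U.card = 2 * (T U).card + (Φ U).card := fun U hU => by
    have hinv : ∀ x, σ x ∈ U ↔ x ∈ U := fun x => by
      conv_lhs => rw [← hU]
      exact Finset.smul_mem_smul_finset_iff σ
    have hsT : ∀ x, x ∈ σ • T U ↔ x ∈ U ∧ e (σ x) < e x := fun x => by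
      have hσ' : σ⁻¹ = σ := inv_eq_of_mul_eq_one_left (Perm.ext h)
      rw [← Finset.inv_smul_mem_iff, hσ', Perm.smul_def, Finset.mem_filter, hinv, h]
    have h1 : U = (T U ∪ σ • T U) ∪ Φ U := by
      ext x
      simp only [Finset.mem_union, hsT, T, Φ, Finset.mem_filter]
      rcases lt_trichotomy (e x) (e (σ x)) with hl | hl | hl
      · simp [hl]; tauto
      · simp [(e.injective hl).symm]
      · simp [hl]; tauto
    refine ⟨h1, ?_⟩
    conv_lhs => rw [h1]
    rw [Finset.card_union_of_disjoint, Finset.card_union_of_disjoint, Finset.card_smul_finset,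
      two_mul]
    · rw [Finset.disjoint_left]
      intro x hx hx'
      exact absurd ((hsT x).1 hx').2 (not_lt.2 (Finset.mem_filter.1 hx).2.le)
    · rw [Finset.disjoint_left]
      intro x hx hx'
      have hf := (Finset.mem_filter.1 hx').2
      rcases Finset.mem_union.1 hx with hx | hx
      · exact absurd (Finset.mem_filter.1 hx).2 (by rw [hf]; exact lt_irrefl _)
      · exact absurd ((hsT x).1 hx).2 (by rw [hf]; exact lt_irrefl _)
  rw [← Finset.card_univ, ← Finset.card_powersetCard]
  refine Finset.card_le_card_of_injOn T ?_ ?_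
  · intro U hU
    obtain ⟨hc, hi⟩ := (Finset.mem_filter.1 hU).2
    refine Finset.mem_powersetCard.2 ⟨Finset.subset_univ _, ?_⟩
    have := (hdec U hi).2
    have := hΦ U
    omega
  · intro U hU U' hU' hT
    obtain ⟨hc, hi⟩ := (Finset.mem_filter.1 hU).2
    obtain ⟨hc', hi'⟩ := (Finset.mem_filter.1 hU').2
    have h1 := hdec U hi
    have h2 := hdec U' hi'
    have hT' : T U = T U' := hT
    have hcard : (Φ U).card = (Φ U').card := by
      rw [← hT'] at h2; omega
    have hΦe : Φ U = Φ U' := by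
      rcases (Φ U).eq_empty_or_nonempty with he | ⟨x, hx⟩
      · rw [he, Finset.card_empty] at hcard
        rw [he, Finset.card_eq_zero.1 hcard.symm]
      · have hx1 : (Φ U').Nonempty := Finset.card_pos.1 (hcard ▸ Finset.card_pos.2 ⟨x, hx⟩)
        obtain ⟨y, hy⟩ := hx1
        have hxy := hfix x y (Finset.mem_filter.1 hx).2 (Finset.mem_filter.1 hy).2
        subst hxy
        exact Finset.Subset.antisymm
          (fun z hz => Finset.card_le_one.1 (hΦ U) x hx z hz ▸ hy)
          (fun z hz => Finset.card_le_one.1 (hΦ U') x hy z hz ▸ hx)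
    rw [h1.1, h2.1, hT', hΦe]

end Perm

/-! ### Elementary properties of uniform probability. -/

section UniformProb

variable {Ω : Type} [Finite Ω]

omit [Finite Ω] in
open Classical in
theorem uniformProb_eq_card_filter [Fintype Ω] (P : Ω → Prop) :
    uniformProb Ω P = (Finset.univ.filter P).card / Fintype.card Ω := by
  rw [uniformProb, Nat.card_eq_fintype_card, Nat.card_eq_fintype_card, Fintype.card_subtype]

omit [Finite Ω] in
theorem uniformProb_nonneg (P : Ω → Prop) : 0 ≤ uniformProb Ω P := by
  unfold uniformProb; positivity

theorem uniformProb_mono {P Q : Ω → Prop} (h : ∀ ω, P ω → Q ω) :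
    uniformProb Ω P ≤ uniformProb Ω Q := by
  classical
  have := Fintype.ofFinite Ω
  rw [uniformProb_eq_card_filter, uniformProb_eq_card_filter]
  gcongr with ω
  exact h ω

theorem uniformProb_le_one (P : Ω → Prop) : uniformProb Ω P ≤ 1 := by
  refine div_le_one_of_le₀ ?_ (Nat.cast_nonneg _)
  exact_mod_cast Finite.card_subtype_le P

theorem uniformProb_eq_one_sub [Nonempty Ω] (P : Ω → Prop) :
    uniformProb Ω P = 1 - uniformProb Ω fun ω => ¬ P ω := by
  classical
  have := Fintype.ofFinite Ω
  rw [uniformProb_eq_card_filter, uniformProb_eq_card_filter, eq_sub_iff_add_eq, ← add_div,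
    ← Nat.cast_add, Finset.card_filter_add_card_filter_not, Finset.card_univ, div_self]
  exact_mod_cast Fintype.card_ne_zero

theorem uniformProb_or_le (P Q : Ω → Prop) :
    uniformProb Ω (fun ω => P ω ∨ Q ω) ≤ uniformProb Ω P + uniformProb Ω Q := by
  classical
  have := Fintype.ofFinite Ω
  rw [uniformProb_eq_card_filter, uniformProb_eq_card_filter, uniformProb_eq_card_filter,
    ← add_div]
  gcongr
  exact_mod_cast (Finset.card_le_card fun ω => by simp).trans (Finset.card_union_le _ _)

theorem uniformProb_exists_le {ι : Type} (S : Finset ι) (Q : ι → Ω → Prop) :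
    uniformProb Ω (fun ω => ∃ i ∈ S, Q i ω) ≤ ∑ i ∈ S, uniformProb Ω (Q i) := by
  classical
  induction S using Finset.induction_on with
  | empty => simp [uniformProb]
  | insert a S ha ih =>
    rw [Finset.sum_insert ha]
    refine le_trans (le_of_eq ?_) ((uniformProb_or_le _ _).trans (add_le_add_right ih _))
    simp

omit [Finite Ω] in
theorem uniformProb_pi (k : ℕ) (Q : Ω → Prop) :
    uniformProb (Fin k → Ω) (fun ω => ∀ j, Q (ω j)) = uniformProb Ω Q ^ k := by
  rw [uniformProb, uniformProb, Nat.card_congr (Equiv.subtypePiEquivPi (p := fun _ => Q)),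
    Nat.card_pi, Nat.card_pi, div_pow]
  simp

omit [Finite Ω] in
theorem uniformProb_subtype (p Q : Ω → Prop) :
    uniformProb {ω // p ω} (fun ω => Q ω.1) =
      Nat.card {ω // p ω ∧ Q ω} / Nat.card {ω // p ω} := by
  rw [uniformProb, Nat.card_congr (Equiv.subtypeSubtypeEquivSubtypeInter p Q)]

omit [Finite Ω] in
theorem natCard_subtype_le_card {p : Ω → Prop} {X : Finset Ω} (h : ∀ ω, p ω → ω ∈ X) :
    Nat.card {ω // p ω} ≤ X.card := by
  rw [← Nat.card_eq_finsetCard]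
  exact Nat.card_le_card_of_injective (fun ω => ⟨ω.1, h ω.1 ω.2⟩) fun ω ω' h =>
    Subtype.ext (congrArg (fun x => x.1) h)

end UniformProb

/-! ### The union bound for failure of expansion. -/

section Core

open scoped Pointwise
open Equiv

/-- With `B = Γ(A)` and `r = |B| - |A|`, failure means `S₀ * r < |A|`. Below size `S₀` this gives `r
= 0`, so each generator exchanges `A` and `B`. -/
theorem exists_invariant_or_joining {n k S₀ : ℕ} (hk : 0 < k) (hS₀ : 0 < S₀)
    (π : Fin k → Perm (Fin n)) (G : LoopGraph (Fin n)) {d : ℕ} (hreg : G.IsRegular d)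
    (hnb : ∀ A : Set (Fin n), G.neighbors A = {v | ∃ j, (π j)⁻¹ v ∈ A ∨ π j v ∈ A})
    (hG : ¬ G.IsSpreader d (1 / S₀)) :
    (∃ U : Finset (Fin n), (0 < U.card ∧ U.card < 2 * S₀) ∧ ∀ j, π j • U = U) ∨
    ∃ s ∈ Finset.Icc S₀ (n / 2), ∃ p ∈ Finset.univ.filter
      (fun p : Finset (Fin n) × Finset (Fin n) => p.1.card = s ∧ p.2.card = s + s / S₀),
      ∀ j, π j • p.1 ⊆ p.2 ∧ p.1 ⊆ π j • p.2 := by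
  classical
  have hS₀' : (0 : ℝ) < S₀ := by exact_mod_cast hS₀
  simp only [LoopGraph.IsSpreader, hreg, true_and, not_forall, not_le] at hG
  obtain ⟨A', hA', hlt⟩ := hG
  obtain ⟨A, rfl⟩ : ∃ A : Finset (Fin n), (A : Set (Fin n)) = A' :=
    ⟨A'.toFinset, by simp⟩
  let B : Finset (Fin n) := Finset.univ.filter fun v => ∃ j, (π j)⁻¹ v ∈ A ∨ π j v ∈ A
  have hB : G.neighbors A = B := by rw [hnb]; ext v; simp [B]
  rw [hB, Set.ncard_coe_finset, Set.ncard_coe_finset] at hlt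
  rw [Set.ncard_coe_finset, Nat.card_eq_fintype_card, Fintype.card_fin, le_div_iff₀ two_pos] at hA'
  have hAn : A.card ≤ n / 2 := by
    rw [Nat.le_div_iff_mul_le two_pos]; exact_mod_cast hA'
  have hlt' : S₀ * B.card < (S₀ + 1) * A.card := by
    have : (S₀ : ℝ) * B.card < (S₀ + 1) * A.card := by
      calc (S₀ : ℝ) * B.card < S₀ * ((1 + 1 / S₀) * A.card) :=
            mul_lt_mul_of_pos_left hlt hS₀'
        _ = _ := by field_simp
    exact_mod_cast this
  have h1 : ∀ j, π j • A ⊆ B := fun j => smul_finset_subset_iff_forall.2 fun x hx => by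
    simp only [B, Finset.mem_filter, Finset.mem_univ, true_and]
    exact ⟨j, Or.inl (by simpa using hx)⟩
  have h2 : ∀ j, A ⊆ π j • B := fun j => subset_smul_finset_iff_forall.2 fun x hx => by
    simp only [B, Finset.mem_filter, Finset.mem_univ, true_and]
    exact ⟨j, Or.inr (by simpa using hx)⟩
  have hAB : A.card ≤ B.card := by
    simpa using Finset.card_le_card (h1 ⟨0, hk⟩)
  obtain ⟨r, hr⟩ := Nat.exists_eq_add_of_le hAB
  have hrA : S₀ * r < A.card := by rw [hr] at hlt'; nlinarith
  rcases lt_or_ge A.card S₀ with hs | hs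
  · left
    have hr0 : r = 0 := by
      by_contra h0
      have := Nat.le_mul_of_pos_right S₀ (Nat.pos_of_ne_zero h0)
      omega
    refine ⟨A ∪ B, ⟨?_, ?_⟩, fun j => ?_⟩
    · have := Finset.card_le_card (Finset.subset_union_left (s₁ := A) (s₂ := B))
      omega
    · have := Finset.card_union_le A B
      omega
    · have e1 : π j • A = B := Finset.eq_of_subset_of_card_le (h1 j) (by simp; omega)
      have e2 : A = π j • B := Finset.eq_of_subset_of_card_le (h2 j) (by simp; omega)
      rw [Finset.smul_finset_union, e1, ← e2, Finset.union_comm]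
  · right
    have hle : r ≤ A.card / S₀ := by
      rw [Nat.le_div_iff_mul_le hS₀, mul_comm]; exact hrA.le
    have hdiv : A.card / S₀ ≤ A.card := Nat.div_le_self _ _
    -- Enlarging `B` to the maximal admissible size leaves one size of `B` to sum over for each `s`.
    obtain ⟨B', hBB', hB'⟩ := Finset.exists_superset_card_eq (s := B)
      (n := A.card + A.card / S₀) (by omega) (by rw [Fintype.card_fin]; omega)
    refine ⟨A.card, Finset.mem_Icc.2 ⟨hs, hAn⟩, (A, B'), by simp [hB'], fun j =>
      ⟨(h1 j).trans hBB', (h2 j).trans (Finset.smul_finset_subset_smul_finset hBB')⟩⟩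

/-- The probability that `k` random permutations give a spreader is estimated by union bounds: over
small invariant sets, and over pairs of large sets that are joined. -/
theorem uniformProb_spreader_ge {n k d m S₀ : ℕ} {c : ℝ} (hc : 0 ≤ c) (hk : 0 < k) (hd : 0 < d) (hS₀ : 0 < S₀)
    (hn : 0 < n) {Ω : Type} [Finite Ω] [Nonempty Ω] (φ : Ω → Perm (Fin n))
    (G : (Fin k → Ω) → LoopGraph (Fin n)) (hreg : ∀ ω, (G ω).IsRegular d)
    (hnb : ∀ ω (A : Set (Fin n)), (G ω).neighbors A =
      {v | ∃ j, (φ (ω j))⁻¹ v ∈ A ∨ φ (ω j) v ∈ A})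
    (h1 : ∀ U : Finset (Fin n), 0 < U.card → U.card < 2 * S₀ →
      (n.choose U.card : ℝ) * n ^ m * uniformProb Ω (fun ω => φ ω • U = U) ^ k ≤ c)
    (h2 : ∀ s, S₀ ≤ s → 2 * s ≤ n → (n : ℝ) ^ (m + 2) * ∑ p ∈ Finset.univ.filter
      (fun p : Finset (Fin n) × Finset (Fin n) => p.1.card = s ∧ p.2.card = s + s / S₀),
      uniformProb Ω (fun ω => φ ω • p.1 ⊆ p.2 ∧ p.1 ⊆ φ ω • p.2) ^ k ≤ 3 * n) :
    1 - (2 * S₀ * c + 3) / n ^ m ≤ uniformProb (Fin k → Ω) fun ω =>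
      (G ω).IsSpreader d (1 / S₀) ∧
        (G ω).NontrivialEigenvaluesLE ((d : ℝ) - (1 / S₀) ^ 2 / (4 * d ^ 3)) := by
  classical
  have hn0 : (0 : ℝ) < n := by exact_mod_cast hn
  have hS₀' : (1 : ℝ) ≤ S₀ := by exact_mod_cast hS₀
  have hmono : uniformProb (Fin k → Ω) (fun ω => (G ω).IsSpreader d (1 / S₀)) ≤
      uniformProb (Fin k → Ω) fun ω => (G ω).IsSpreader d (1 / S₀) ∧
        (G ω).NontrivialEigenvaluesLE ((d : ℝ) - (1 / S₀) ^ 2 / (4 * d ^ 3)) :=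
    uniformProb_mono fun ω h => ⟨h, h.nontrivialEigenvaluesLE hd (by positivity)
      (by rw [div_le_one (by linarith)]; exact hS₀')⟩
  refine le_trans ?_ hmono
  rw [uniformProb_eq_one_sub]
  refine sub_le_sub_left ?_ _
  refine (uniformProb_mono fun ω h =>
    exists_invariant_or_joining hk hS₀ (fun j => φ (ω j)) (G ω) (hreg ω) (hnb ω) h).trans ?_
  refine (uniformProb_or_le _ _).trans ?_
  have e1 : uniformProb (Fin k → Ω) (fun ω => ∃ U : Finset (Fin n),
      (0 < U.card ∧ U.card < 2 * S₀) ∧ ∀ j, φ (ω j) • U = U) ≤ 2 * S₀ * c / n ^ m := by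
    let 𝒰 := Finset.univ.filter fun U : Finset (Fin n) => 0 < U.card ∧ U.card < 2 * S₀
    calc _ = uniformProb (Fin k → Ω) (fun ω => ∃ U ∈ 𝒰, ∀ j, φ (ω j) • U = U) := by simp [𝒰]
      _ ≤ ∑ U ∈ 𝒰, uniformProb (Fin k → Ω) (fun ω => ∀ j, φ (ω j) • U = U) :=
          uniformProb_exists_le _ _
      _ = ∑ U ∈ 𝒰, uniformProb Ω (fun ω => φ ω • U = U) ^ k :=
          Finset.sum_congr rfl fun U _ => uniformProb_pi k fun ω => φ ω • U = U
      _ = ∑ u ∈ Finset.range (2 * S₀), ∑ U ∈ 𝒰.filter (fun U => U.card = u),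
            uniformProb Ω (fun ω => φ ω • U = U) ^ k :=
          (Finset.sum_fiberwise_of_maps_to (fun U hU =>
            Finset.mem_range.2 (Finset.mem_filter.1 hU).2.2) _).symm
      _ ≤ ∑ u ∈ Finset.range (2 * S₀), c / n ^ m := by
          refine Finset.sum_le_sum fun u _ => ?_
          rcases (𝒰.filter fun U => U.card = u).eq_empty_or_nonempty with he | ⟨W, hW⟩
          · rw [he, Finset.sum_empty]
            positivity
          · obtain ⟨hW1, hW2⟩ := Finset.mem_filter.1 hW
            have hun : u ≤ n := by
              have := Finset.card_le_univ W; rw [Fintype.card_fin] at this; omega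
            have hC : (0 : ℝ) < n.choose u := by exact_mod_cast Nat.choose_pos hun
            calc _ ≤ ∑ U ∈ 𝒰.filter (fun U => U.card = u), c / n ^ m / n.choose u := by
                  refine Finset.sum_le_sum fun U hU => ?_
                  obtain ⟨hU1, hU2⟩ := Finset.mem_filter.1 hU
                  have hU3 := (Finset.mem_filter.1 hU1).2
                  have := h1 U hU3.1 hU3.2
                  rw [hU2] at this
                  rw [div_div, le_div_iff₀ (by positivity)]
                  linarith
              _ = (𝒰.filter fun U => U.card = u).card * (c / n ^ m / n.choose u) := by
                  rw [Finset.sum_const, nsmul_eq_mul]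
              _ = n.choose u * (c / n ^ m / n.choose u) := by
                  have hW3 := (Finset.mem_filter.1 hW1).2
                  have : 𝒰.filter (fun U => U.card = u) = Finset.univ.powersetCard u := by
                    ext U
                    simp only [𝒰, Finset.mem_filter, Finset.mem_univ, true_and,
                      Finset.mem_powersetCard, Finset.subset_univ]
                    exact ⟨fun h => h.2, fun h => ⟨by omega, h⟩⟩
                  rw [this, Finset.card_powersetCard, Finset.card_univ, Fintype.card_fin]
              _ = c / n ^ m := by field_simp
      _ = 2 * S₀ * c / n ^ m := by
          rw [Finset.sum_const, Finset.card_range, nsmul_eq_mul]; push_cast; ring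
  have e2 : uniformProb (Fin k → Ω) (fun ω => ∃ s ∈ Finset.Icc S₀ (n / 2), ∃ p ∈ Finset.univ.filter
      (fun p : Finset (Fin n) × Finset (Fin n) => p.1.card = s ∧ p.2.card = s + s / S₀),
      ∀ j, φ (ω j) • p.1 ⊆ p.2 ∧ p.1 ⊆ φ (ω j) • p.2) ≤ 3 / n ^ m := by
    -- One of the two extra powers of `n` pays for the number of sizes `s`, the other for the factor
    -- `n` in `3 * n`.
    calc _ ≤ ∑ s ∈ Finset.Icc S₀ (n / 2), 3 * n / (n : ℝ) ^ (m + 2) := by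
          refine (uniformProb_exists_le _ _).trans (Finset.sum_le_sum fun s hs => ?_)
          refine (uniformProb_exists_le _ _).trans ?_
          obtain ⟨hs1, hs2⟩ := Finset.mem_Icc.1 hs
          rw [le_div_iff₀ (by positivity), mul_comm]
          refine le_trans (le_of_eq ?_) (h2 s hs1 (by omega))
          congr 1
          exact Finset.sum_congr rfl fun p _ =>
            uniformProb_pi k fun ω => φ ω • p.1 ⊆ p.2 ∧ p.1 ⊆ φ ω • p.2
      _ ≤ n * (3 * n / (n : ℝ) ^ (m + 2)) := by
          rw [Finset.sum_const, nsmul_eq_mul, Nat.card_Icc]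
          refine mul_le_mul_of_nonneg_right ?_ (by positivity)
          exact_mod_cast (by omega : n / 2 + 1 - S₀ ≤ n)
      _ = 3 / n ^ m := by rw [pow_add]; field_simp
  calc _ ≤ 2 * S₀ * c / n ^ m + 3 / n ^ m := add_le_add e1 e2
    _ = _ := by ring

end Core

/-! ### Sizes of the sample spaces, and the bound for each pair. -/

section Counting

open scoped Pointwise
open Equiv

/-- There are `(2m)! / (2^m m!)` perfect matchings of `2m` points. By the central binomial estimate
the square of this is at least `(2m)! / (2m)`: pairs of matchings are almost as numerous as
permutations. -/
theorem factorial_two_mul_le_of_mul_ge {N m : ℕ} (hm : 0 < m)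
    (h : (2 * m).factorial ≤ N * (2 ^ m * m.factorial)) :
    (2 * m).factorial ≤ N ^ 2 * (2 * m) := by
  have h1 := Nat.four_pow_le_two_mul_self_mul_centralBinom m hm
  have h2 : (2 * m).factorial = m.centralBinom * m.factorial * m.factorial := by
    rw [Nat.centralBinom, ← Nat.choose_mul_factorial_mul_factorial (by omega : m ≤ 2 * m)]
    congr 2; omega
  have h3 : 4 ^ m * (m.factorial * m.factorial) ≤ 2 * m * (2 * m).factorial := by
    calc 4 ^ m * (m.factorial * m.factorial) ≤
          2 * m * m.centralBinom * (m.factorial * m.factorial) := Nat.mul_le_mul_right _ h1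
      _ = 2 * m * (2 * m).factorial := by rw [h2]; ring
  refine Nat.le_of_mul_le_mul_left (c := (2 * m).factorial) ?_ (Nat.factorial_pos _)
  calc (2 * m).factorial * (2 * m).factorial
      ≤ (N * (2 ^ m * m.factorial)) * (N * (2 ^ m * m.factorial)) := Nat.mul_le_mul h h
    _ = N ^ 2 * (4 ^ m * (m.factorial * m.factorial)) := by
        rw [show 4 = 2 * 2 from rfl, mul_pow 2 2]; ring
    _ ≤ N ^ 2 * (2 * m * (2 * m).factorial) := Nat.mul_le_mul_left _ h3
    _ = _ := by ring

variable {V : Type} [Fintype V] [DecidableEq V]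

theorem card_cycleType_replicate_two_mul {m : ℕ} (hm : 0 < m) (h : 2 * m ≤ Fintype.card V) :
    (Finset.univ.filter fun σ : Perm V => σ.cycleType = Multiset.replicate m 2).card *
      ((Fintype.card V - 2 * m).factorial * (2 ^ m * m.factorial)) =
      (Fintype.card V).factorial := by
  have := Equiv.Perm.card_of_cycleType_mul_eq V (Multiset.replicate m 2)
  rw [if_pos] at this
  · rw [← this]
    have hf : (Multiset.replicate m 2).toFinset = {2} := by
      rw [Multiset.toFinset_replicate, if_neg hm.ne']
    rw [hf, Finset.prod_singleton, Multiset.count_replicate_self, Multiset.sum_replicate,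
      Multiset.prod_replicate, smul_eq_mul, mul_comm m 2, mul_assoc (Nat.factorial _)]
  · refine ⟨by simp [mul_comm m 2, h], fun a ha => ?_⟩
    rw [Multiset.eq_of_mem_replicate ha]

theorem involutive_of_cycleType_eq_replicate_two {m : ℕ} {σ : Perm V}
    (h : σ.cycleType = Multiset.replicate m 2) (x : V) : σ (σ x) = x := by
  have : σ ^ 2 = 1 := (Equiv.Perm.pow_prime_eq_one_iff (p := 2)).2 fun c hc => by
    rw [h] at hc; exact Multiset.eq_of_mem_replicate hc
  have := congrArg (fun τ : Perm V => τ x) this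
  simpa [pow_two] using this

theorem card_support_of_cycleType_eq_replicate_two {m : ℕ} {σ : Perm V}
    (h : σ.cycleType = Multiset.replicate m 2) : σ.support.card = 2 * m := by
  rw [← Equiv.Perm.sum_cycleType, h, Multiset.sum_replicate, smul_eq_mul, mul_comm]

/-- A lower bound for the number of perfect matchings. -/
theorem factorial_le_card_perfectMatching (hV : 0 < Fintype.card V) (he : Even (Fintype.card V)) :
    (Fintype.card V).factorial ≤ Nat.card {σ : Perm V //
      (∀ x, σ (σ x) = x) ∧ ∀ x, σ x ≠ x} ^ 2 * Fintype.card V := by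
  classical
  rw [Nat.card_eq_fintype_card, Fintype.card_subtype]
  obtain ⟨m, hm⟩ := he
  rw [← two_mul] at hm
  have h1 := card_cycleType_replicate_two_mul (V := V) (m := m) (by omega) (by omega)
  rw [hm] at h1 ⊢
  refine factorial_two_mul_le_of_mul_ge (by omega) ?_
  rw [← h1, Nat.sub_self, Nat.factorial_zero, one_mul]
  refine Nat.mul_le_mul_right _ (Finset.card_le_card fun σ hσ => ?_)
  have hσ' := (Finset.mem_filter.1 hσ).2
  refine Finset.mem_filter.2 ⟨Finset.mem_univ _, involutive_of_cycleType_eq_replicate_two hσ',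
    fun x => ?_⟩
  have : σ.support = Finset.univ := Finset.eq_univ_of_card _ (by
    rw [card_support_of_cycleType_eq_replicate_two hσ', hm])
  exact Perm.mem_support.1 (this ▸ Finset.mem_univ x)

/-- A lower bound for the number of near perfect matchings. -/
theorem factorial_le_card_nearPerfectMatching (hV : 1 < Fintype.card V)
    (ho : Odd (Fintype.card V)) :
    (Fintype.card V + 1).factorial ≤ Nat.card {σ : Perm V //
      (∀ x, σ (σ x) = x) ∧ ∃! x, σ x = x} ^ 2 * (Fintype.card V + 1) := by
  classical
  rw [Nat.card_eq_fintype_card, Fintype.card_subtype]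
  obtain ⟨m, hm⟩ := ho
  have h1 := card_cycleType_replicate_two_mul (V := V) (m := m) (by omega) (by omega)
  rw [hm] at h1 ⊢
  refine factorial_two_mul_le_of_mul_ge (m := m + 1) (by omega) ?_
  rw [show 2 * (m + 1) = 2 * m + 1 + 1 by ring, Nat.factorial_succ (2 * m + 1), ← h1,
    show 2 * m + 1 - 2 * m = 1 by omega, Nat.factorial_one, one_mul, pow_succ,
    Nat.factorial_succ m]
  calc _ = (Finset.univ.filter fun σ : Perm V => σ.cycleType = Multiset.replicate m 2).card *
        (2 ^ m * 2 * ((m + 1) * m.factorial)) := by ring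
    _ ≤ _ := by
      refine Nat.mul_le_mul_right _ (Finset.card_le_card fun σ hσ => ?_)
      have hσ' := (Finset.mem_filter.1 hσ).2
      refine Finset.mem_filter.2 ⟨Finset.mem_univ _,
        involutive_of_cycleType_eq_replicate_two hσ', ?_⟩
      have hc : (σ.supportᶜ).card = 1 := by
        rw [Finset.card_compl, card_support_of_cycleType_eq_replicate_two hσ', hm]; omega
      obtain ⟨x, hx⟩ := Finset.card_eq_one.1 hc
      have hx' : ∀ y, σ y = y ↔ y = x := fun y => by
        have := congrArg (y ∈ ·) hx
        simpa using this
      exact ⟨x, (hx' x).2 rfl, fun y hy => (hx' y).1 hy⟩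

/-- A lower bound for the number of full cycles. -/
theorem factorial_le_card_fullCycle (hV : 1 < Fintype.card V) :
    (Fintype.card V).factorial ≤ Nat.card {σ : Perm V //
      ∀ x y, σ.SameCycle x y} * Fintype.card V := by
  classical
  rw [Nat.card_eq_fintype_card, Fintype.card_subtype]
  have := Equiv.Perm.card_of_cycleType_mul_eq V {Fintype.card V}
  rw [if_pos (by simp; omega)] at this
  simp only [Multiset.sum_singleton, Nat.sub_self, Nat.factorial_zero, Multiset.prod_singleton,
    one_mul, Multiset.toFinset_singleton, Finset.prod_singleton, Multiset.count_singleton_self,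
    Nat.factorial_one, mul_one] at this
  rw [← this]
  refine Nat.mul_le_mul_right _ (Finset.card_le_card fun σ hσ => ?_)
  have hσ' := (Finset.mem_filter.1 hσ).2
  refine Finset.mem_filter.2 ⟨Finset.mem_univ _, fun x y => ?_⟩
  have hc : σ.IsCycle := Equiv.Perm.card_cycleType_eq_one.1 (by rw [hσ']; simp)
  have hs : σ.support = Finset.univ := Finset.eq_univ_of_card _ (by
    rw [← Equiv.Perm.sum_cycleType, hσ', Multiset.sum_singleton])
  exact hc.sameCycle (Perm.mem_support.1 (hs ▸ Finset.mem_univ x))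
    (Perm.mem_support.1 (hs ▸ Finset.mem_univ y))

/-- Double counting of the invariant sets of the members of a set of permutations that is closed
under conjugation. -/
theorem card_invariant_mul_choose_le (M : Finset (Perm V))
    (hM : ∀ τ : Perm V, ∀ σ ∈ M, τ * σ * τ⁻¹ ∈ M) {b : ℕ} {U : Finset V}
    (hb : ∀ σ ∈ M, (Finset.univ.filter fun U' : Finset V =>
      U'.card = U.card ∧ σ • U' = U').card ≤ b) :
    (M.filter fun σ => σ • U = U).card * (Fintype.card V).choose U.card ≤ M.card * b := by
  have h1 : ∀ U' ∈ (Finset.univ : Finset V).powersetCard U.card,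
      (M.filter fun σ => σ • U = U).card ≤ (M.filter fun σ => σ • U' = U').card := by
    intro U' hU'
    have hc := (Finset.mem_powersetCard.1 hU').2
    obtain ⟨τ, hτ, -⟩ := exists_perm_smul_pair (A := U) (B := U) (A' := U') (B' := U') hc hc
      (by simp [hc])
    refine Finset.card_le_card_of_injOn (fun σ => τ * σ * τ⁻¹) ?_ ?_
    · intro σ hσ
      obtain ⟨h1, h2⟩ := Finset.mem_filter.1 hσ
      refine Finset.mem_filter.2 ⟨hM τ σ h1, ?_⟩
      rw [← hτ, mul_smul, inv_smul_smul, mul_smul, h2]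
    · intro σ _ σ' _ h
      exact mul_left_cancel (mul_right_cancel h)
  calc (M.filter fun σ => σ • U = U).card * (Fintype.card V).choose U.card
      = ∑ _U' ∈ (Finset.univ : Finset V).powersetCard U.card,
          (M.filter fun σ => σ • U = U).card := by
        rw [Finset.sum_const, Finset.card_powersetCard, Finset.card_univ, smul_eq_mul, mul_comm]
    _ ≤ ∑ U' ∈ (Finset.univ : Finset V).powersetCard U.card,
          (M.filter fun σ => σ • U' = U').card := Finset.sum_le_sum h1
    _ = ∑ σ ∈ M, (((Finset.univ : Finset V).powersetCard U.card).filter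
          fun U' => σ • U' = U').card := by
        simp only [Finset.card_filter]
        exact Finset.sum_comm
    _ ≤ ∑ _σ ∈ M, b := by
        refine Finset.sum_le_sum fun σ hσ => le_trans (Finset.card_le_card fun U' h => ?_) (hb σ hσ)
        obtain ⟨h1, h2⟩ := Finset.mem_filter.1 h
        exact Finset.mem_filter.2 ⟨Finset.mem_univ _, (Finset.mem_powersetCard.1 h1).2, h2⟩
    _ = M.card * b := by rw [Finset.sum_const, smul_eq_mul]

/-- The bound that the pair of sets `(A, B)` contributes to the union bound. -/
noncomputable def joinBound (A B : Finset V) : ℝ :=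
  Real.sqrt ((Fintype.card V * (joiningPerms A B).card / (Fintype.card V).factorial) ^ 3)

theorem joinBound_nonneg (A B : Finset V) : 0 ≤ joinBound A B := Real.sqrt_nonneg _

/-- Two permutations give the exponent `2`, more than the required `3/2`. -/
theorem pow_le_joinBound_of_le {p : ℝ} {k : ℕ} (hk : 2 ≤ k) (hp0 : 0 ≤ p) (hp1 : p ≤ 1)
    {A B : Finset V}
    (hp : p ≤ Fintype.card V * (joiningPerms A B).card / (Fintype.card V).factorial) :
    p ^ k ≤ joinBound A B := by
  refine Real.le_sqrt_of_sq_le ?_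
  rw [← pow_mul]
  exact (pow_le_pow_of_le_one hp0 hp1 (by omega)).trans (pow_le_pow_left₀ hp0 hp 3)

/-- Each matching gives the exponent `1/2`, so three of them just reach `3/2`. -/
theorem pow_le_joinBound_of_sq_le {p : ℝ} {k : ℕ} (hk : 3 ≤ k) (hp0 : 0 ≤ p) (hp1 : p ≤ 1)
    {A B : Finset V}
    (hp : p ^ 2 ≤ Fintype.card V * (joiningPerms A B).card / (Fintype.card V).factorial) :
    p ^ k ≤ joinBound A B := by
  refine Real.le_sqrt_of_sq_le ?_
  calc (p ^ k) ^ 2 = p ^ (k * 2) := by rw [← pow_mul]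
    _ ≤ p ^ (2 * 3) := pow_le_pow_of_le_one hp0 hp1 (by omega)
    _ = (p ^ 2) ^ 3 := by rw [pow_mul]
    _ ≤ _ := pow_le_pow_left₀ (sq_nonneg p) hp 3

theorem sum_joinBound_le {D s r : ℕ} (hs0 : 0 < s) (hs : 4 * (2 * D + 3) ≤ s)
    (hsn : 2 * s ≤ Fintype.card V) (hn : (4 * (2 * D + 3)) ^ 2 ≤ Fintype.card V)
    (hr : 576 * r ≤ s) :
    (Fintype.card V : ℝ) ^ D * ∑ p ∈ Finset.univ.filter
      (fun p : Finset V × Finset V => p.1.card = s ∧ p.2.card = s + r), joinBound p.1 p.2 ≤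
      Fintype.card V + 1 :=
  sum_pairs_le hs0 hs hsn hn hr _ fun A B _ _ => by
    rw [joinBound, Real.sq_sqrt (by positivity)]

theorem sum_joinBound_option_le {D s r : ℕ} (hs0 : 0 < s) (hs : 4 * (2 * D + 3) ≤ s)
    (hsn : 2 * s ≤ Fintype.card V) (hn : (4 * (2 * D + 3)) ^ 2 ≤ Fintype.card V)
    (hr : 576 * (r + 1) ≤ s) :
    (Fintype.card V : ℝ) ^ D * ∑ p ∈ Finset.univ.filter
      (fun p : Finset V × Finset V => p.1.card = s ∧ p.2.card = s + r),
        joinBound (p.1.map Function.Embedding.some) (Finset.insertNone p.2) ≤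
      Fintype.card V + 2 := by
  have hc : Fintype.card (Option V) = Fintype.card V + 1 := Fintype.card_option
  -- The added vertex enlarges only the second set, so the excess becomes `r + 1`; the pairs of `V`
  -- embed among those of `Option V`.
  have h := sum_joinBound_le (V := Option V) (D := D) (s := s) (r := r + 1) hs0 hs (by omega)
    (by omega) hr
  rw [hc, Nat.cast_add, Nat.cast_one] at h
  let ι : Finset V × Finset V → Finset (Option V) × Finset (Option V) := fun p =>
    (p.1.map Function.Embedding.some, Finset.insertNone p.2)
  have hι : Function.Injective ι := fun p q hpq => by
    have h1 := congrArg Prod.fst hpq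
    have h2 := congrArg Prod.snd hpq
    exact Prod.ext (Finset.map_injective _ h1) (Finset.insertNone.injective h2)
  refine le_trans (mul_le_mul (pow_le_pow_left₀ (Nat.cast_nonneg _) (by linarith) D) ?_
    (Finset.sum_nonneg fun _ _ => joinBound_nonneg _ _) (by positivity)) (h.trans (by linarith))
  rw [← Finset.sum_image (f := fun q : Finset (Option V) × Finset (Option V) => joinBound q.1 q.2)
    (g := ι) (fun p _ q _ h => hι h)]
  refine Finset.sum_le_sum_of_subset_of_nonneg ?_ fun _ _ _ => joinBound_nonneg _ _
  intro q hq
  obtain ⟨p, hp, rfl⟩ := Finset.mem_image.1 hq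
  obtain ⟨h1, h2⟩ := (Finset.mem_filter.1 hp).2
  exact Finset.mem_filter.2 ⟨Finset.mem_univ _, by simp [ι, h1], by simp [ι, h2, add_assoc]⟩

end Counting

/-! ### Regularity and neighbourhoods in the model graphs. -/

namespace LoopGraph

theorem isRegular_ofPerms {V : Type} [Finite V] {k : ℕ} (π : Fin k → Equiv.Perm V) :
    (ofPerms π).IsRegular (2 * k) := by
  intro v
  let e : {e : (ofPerms π).E // (ofPerms π).src e = v} ≃ Fin k × Bool :=
    { toFun := fun e => (e.1.1, e.1.2.2)
      invFun := fun x => ⟨(x.1, if x.2 then v else (π x.1).symm v, x.2), by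
        obtain ⟨j, _ | _⟩ := x <;> simp [ofPerms]⟩
      left_inv := by
        rintro ⟨⟨j, w, _ | _⟩, h⟩
        · simp only [ofPerms, Bool.false_eq_true, if_false] at h
          subst h
          simp
        · simp only [ofPerms, if_true] at h
          subst h
          simp
      right_inv := fun x => rfl }
  rw [Nat.card_congr e]
  simp [mul_comm]

theorem neighbors_ofPerms {V : Type} [Finite V] {k : ℕ} (π : Fin k → Equiv.Perm V) (A : Set V) :
    (ofPerms π).neighbors A = {v | ∃ j, (π j)⁻¹ v ∈ A ∨ π j v ∈ A} := by
  ext v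
  constructor
  · rintro ⟨⟨j, w, _ | _⟩, h1, h2⟩
    · simp only [ofPerms, Bool.false_eq_true, if_false] at h1 h2
      subst h2
      exact ⟨j, Or.inr h1⟩
    · simp only [ofPerms, if_true] at h1 h2
      subst h2
      exact ⟨j, Or.inl (by simpa using h1)⟩
  · rintro ⟨j, h | h⟩
    · exact ⟨(j, (π j)⁻¹ v, true), by simpa [ofPerms] using h, by simp [ofPerms]⟩
    · exact ⟨(j, v, false), by simpa [ofPerms] using h, by simp [ofPerms]⟩

theorem isRegular_ofInvolutions {V : Type} [Finite V] {k : ℕ} (σ : Fin k → Equiv.Perm V)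
    (hσ : ∀ j v, σ j (σ j v) = v) : (ofInvolutions σ hσ).IsRegular k := by
  intro v
  let e : {e : (ofInvolutions σ hσ).E // (ofInvolutions σ hσ).src e = v} ≃ Fin k :=
    { toFun := fun e => e.1.1
      invFun := fun j => ⟨(j, v), rfl⟩
      left_inv := by
        rintro ⟨⟨j, w⟩, h⟩
        simp only [ofInvolutions] at h
        subst h
        rfl
      right_inv := fun x => rfl }
  rw [Nat.card_congr e]
  simp

theorem neighbors_ofInvolutions {V : Type} [Finite V] {k : ℕ} (σ : Fin k → Equiv.Perm V)
    (hσ : ∀ j v, σ j (σ j v) = v) (A : Set V) :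
    (ofInvolutions σ hσ).neighbors A = {v | ∃ j, (σ j)⁻¹ v ∈ A ∨ σ j v ∈ A} := by
  have hinv : ∀ j v, (σ j)⁻¹ v = σ j v := fun j v => by
    rw [Equiv.Perm.inv_eq_iff_eq, hσ]
  ext v
  constructor
  · rintro ⟨⟨j, w⟩, h1, h2⟩
    simp only [ofInvolutions] at h1 h2
    subst h2
    exact ⟨j, Or.inl (by simpa using h1)⟩
  · rintro ⟨j, h | h⟩
    · exact ⟨(j, (σ j)⁻¹ v), h, by simp [ofInvolutions]⟩
    · exact ⟨(j, σ j v), h, hσ j v⟩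

end LoopGraph

/-! ### The four models. -/

section Models

open scoped Pointwise
open Equiv

/-- The size below which sets of vertices are treated by counting small invariant sets, when the
failure probability is to be of order `n ^ (-m)`. -/
def smallSize (m : ℕ) : ℕ := 8 * m + 1180

/-- The factor is `2 * 576`: together with `1152 ≤ s` it yields `576 * (r + 1) ≤ s`, as needed when
a vertex is added. -/
theorem mul_div_smallSize_le (m s : ℕ) : 1152 * (s / smallSize m) ≤ s :=
  (Nat.mul_le_mul_right _ (by unfold smallSize; omega)).trans (Nat.mul_div_le s (smallSize m))

/-- For `d = 2k` the claim reduces to `√(2k - 1) ≤ 2k - 1`. So the failure bound of order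
`n^(-(d/2-1))` is good enough. -/
theorem tauFundG_le {d : ℕ} (hd : 4 ≤ d) (he : Even d) : tauFundG d ≤ ((d / 2 - 1 : ℕ) : ℤ) := by
  obtain ⟨k, rfl⟩ := he
  have hk : 2 ≤ k := by omega
  have hk' : (2 : ℝ) ≤ k := by exact_mod_cast hk
  rw [show (k + k) / 2 - 1 = k - 1 by omega, Nat.cast_sub (by omega), tauFundG]
  refine sub_le_sub_right (Int.ceil_le.2 ?_) _
  have : Real.sqrt (((k + k : ℕ) : ℝ) - 1) ≤ 2 * k - 1 :=
    Real.sqrt_le_iff.2 ⟨by linarith, by push_cast; nlinarith⟩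
  push_cast at this ⊢
  linarith

theorem tauFundHIJ_le {d : ℕ} (hd : 3 ≤ d) : tauFundHIJ d ≤ ((d - 2 : ℕ) : ℤ) := by
  have hd' : (3 : ℝ) ≤ d := by exact_mod_cast hd
  rw [Nat.cast_sub (by omega), tauFundHIJ, show ((d : ℤ) - (2 : ℕ)) = ((d : ℤ) - 1) - 1 by
    push_cast; ring]
  refine sub_le_sub_right (Int.ceil_le.2 ?_) _
  push_cast
  exact Real.sqrt_le_iff.2 ⟨by linarith, by nlinarith⟩

/-- A bound for all large `n` becomes a bound for all `n` when the constant is enlarged. -/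
theorem exists_constants_of_eventually {d m S₀ n₀ : ℕ} {τ : ℤ} {c : ℝ} (hd : 0 < d)
    (hS₀ : 0 < S₀) (hc : 0 ≤ c) (hτ : τ ≤ m) (cond : ℕ → Prop) (f : ℝ → ℝ → ℕ → ℝ)
    (hf : ∀ γ ε n, 0 ≤ f γ ε n)
    (h : ∀ n, n₀ ≤ n → 0 < n → cond n →
      1 - c / n ^ m ≤ f (1 / S₀) ((1 / S₀) ^ 2 / (4 * d ^ 3)) n) :
    ∃ γ : ℝ, 0 < γ ∧ ∃ ε : ℝ, 0 < ε ∧ ∃ C : ℝ, ∀ n : ℕ, 0 < n → cond n →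
      1 - C * (n : ℝ) ^ (-τ) ≤ f γ ε n := by
  have hS₀' : (0 : ℝ) < S₀ := by exact_mod_cast hS₀
  have hd' : (0 : ℝ) < d := by exact_mod_cast hd
  -- The summand `n₀ ^ m` makes the claimed lower bound nonpositive for `n < n₀`.
  refine ⟨1 / S₀, by positivity, (1 / S₀) ^ 2 / (4 * d ^ 3), by positivity, c + n₀ ^ m,
    fun n hn hcond => ?_⟩
  have hn' : (1 : ℝ) ≤ n := by exact_mod_cast hn
  have hpow : 1 / (n : ℝ) ^ m ≤ (n : ℝ) ^ (-τ) := by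
    rw [one_div, ← zpow_natCast, ← zpow_neg]
    exact zpow_le_zpow_right₀ hn' (by omega)
  have hge : (c + (n₀ : ℝ) ^ m) * (1 / (n : ℝ) ^ m) ≤ (c + n₀ ^ m) * (n : ℝ) ^ (-τ) :=
    mul_le_mul_of_nonneg_left hpow (by positivity)
  have e : (c + (n₀ : ℝ) ^ m) * (1 / (n : ℝ) ^ m) = c / n ^ m + n₀ ^ m / n ^ m := by ring
  have h0 : 0 ≤ (n₀ : ℝ) ^ m / n ^ m := by positivity
  rcases le_or_gt n₀ n with hle | hlt
  · have := h n hle hn hcond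
    linarith
  · have h1 : (1 : ℝ) ≤ (n₀ : ℝ) ^ m / n ^ m := by
      rw [one_le_div (by positivity)]
      exact pow_le_pow_left₀ (by linarith) (by exact_mod_cast hlt.le) m
    have h2 : 0 ≤ c / (n : ℝ) ^ m := by positivity
    linarith [hf (1 / S₀) ((1 / S₀) ^ 2 / (4 * d ^ 3)) n]

theorem sum_le_of_le_joinBound {n m : ℕ} (hn : smallSize m ^ 2 ≤ n)
    {P : Finset (Fin n) → Finset (Fin n) → ℝ} (hP : ∀ A B, P A B ≤ joinBound A B) (s : ℕ)
    (hs : smallSize m ≤ s) (hsn : 2 * s ≤ n) :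
    (n : ℝ) ^ (m + 2) * ∑ p ∈ Finset.univ.filter (fun p : Finset (Fin n) × Finset (Fin n) =>
      p.1.card = s ∧ p.2.card = s + s / smallSize m), P p.1 p.2 ≤ 3 * n := by
  have hdiv := mul_div_smallSize_le m s
  have hn1 : 4 * (2 * (m + 2) + 3) ≤ smallSize m := by unfold smallSize; omega
  have hs0 : 0 < s := lt_of_lt_of_le (by unfold smallSize; omega) hs
  have key := sum_joinBound_le (V := Fin n) (D := m + 2) (s := s) (r := s / smallSize m) hs0
    (hn1.trans hs) (by simpa using hsn)
    (by rw [Fintype.card_fin]; exact (Nat.pow_le_pow_left hn1 2).trans hn) (by omega)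
  rw [Fintype.card_fin] at key
  have h1 : (1 : ℝ) ≤ n := by exact_mod_cast (by omega : 1 ≤ n)
  refine le_trans (mul_le_mul_of_nonneg_left (Finset.sum_le_sum fun p _ => hP p.1 p.2)
    (by positivity)) (key.trans (by linarith))

theorem sum_le_of_le_joinBound_option {n m : ℕ} (hn : smallSize m ^ 2 ≤ n)
    {P : Finset (Fin n) → Finset (Fin n) → ℝ}
    (hP : ∀ A B, P A B ≤ joinBound (A.map Function.Embedding.some) (Finset.insertNone B)) (s : ℕ)
    (hs : smallSize m ≤ s) (hsn : 2 * s ≤ n) :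
    (n : ℝ) ^ (m + 2) * ∑ p ∈ Finset.univ.filter (fun p : Finset (Fin n) × Finset (Fin n) =>
      p.1.card = s ∧ p.2.card = s + s / smallSize m), P p.1 p.2 ≤ 3 * n := by
  have hdiv := mul_div_smallSize_le m s
  have hn1 : 4 * (2 * (m + 2) + 3) ≤ smallSize m := by unfold smallSize; omega
  have hs1 : 1152 ≤ s := le_trans (by unfold smallSize; omega) hs
  have key := sum_joinBound_option_le (V := Fin n) (D := m + 2) (s := s) (r := s / smallSize m)
    (by omega) (hn1.trans hs) (by simpa using hsn)
    (by rw [Fintype.card_fin]; exact (Nat.pow_le_pow_left hn1 2).trans hn) (by omega)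
  rw [Fintype.card_fin] at key
  have h1 : (1 : ℝ) ≤ n := by exact_mod_cast (by omega : 1 ≤ n)
  refine le_trans (mul_le_mul_of_nonneg_left (Finset.sum_le_sum fun p _ => hP p.1 p.2)
    (by positivity)) (key.trans (by linarith))

/-- Passing to a subfamily of at least `F / n` among `F` permutations multiplies probabilities by at
most `n`. -/
theorem cast_div_le_mul_div {a g N n F : ℕ} (hF : 0 < F) (ha : a ≤ g) (h : F ≤ N * n) :
    (a : ℝ) / N ≤ n * g / F := by
  have hN : 0 < N := Nat.pos_of_ne_zero fun h0 => by simp [h0] at h; omega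
  rw [div_le_div_iff₀ (by exact_mod_cast hN) (by exact_mod_cast hF)]
  exact_mod_cast (Nat.mul_le_mul ha h).trans (le_of_eq (by ring))

theorem cast_div_sq_le_mul_div {a g N n F : ℕ} (hF : 0 < F) (ha : a ^ 2 ≤ g)
    (h : F ≤ N ^ 2 * n) : ((a : ℝ) / N) ^ 2 ≤ n * g / F := by
  rw [div_pow]
  exact_mod_cast cast_div_le_mul_div hF ha h

/-- The union bound over small invariant sets for matchings. -/
theorem choose_mul_pow_mul_le {n u d S : ℕ} {p : ℝ} (hd : 2 ≤ d) (hu : 0 < u) (hun : u ≤ n)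
    (huS : u ≤ S) (hp0 : 0 ≤ p) (hp : p ≤ n.choose (u / 2) / n.choose u) :
    (n.choose u : ℝ) * n ^ (d - 2) * p ^ d ≤ (S ^ S) ^ (d - 1) := by
  have hC : 0 < n.choose u := Nat.choose_pos hun
  have hC' : (0 : ℝ) < n.choose u := by exact_mod_cast hC
  -- Comparison of degrees in `n`. Equality holds at `u = 2`, two vertices matched to each other by
  -- all `d` matchings, which is why the exponent is `d - 2`.
  have hexp : d - 2 + u / 2 * d ≤ u * (d - 1) := by
    obtain ⟨e, rfl⟩ := Nat.exists_eq_add_of_le hd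
    rw [show 2 + e - 2 = e by omega, show 2 + e - 1 = e + 1 by omega]
    obtain ⟨h, rfl | rfl⟩ := Nat.even_or_odd' u
    · rw [Nat.mul_div_cancel_left _ two_pos]
      have : e ≤ h * e := Nat.le_mul_of_pos_left e (by omega)
      nlinarith
    · rw [show (2 * h + 1) / 2 = h by omega]
      nlinarith [Nat.zero_le (h * e)]
  have hnat : n ^ (d - 2) * n.choose (u / 2) ^ d ≤ (S ^ S) ^ (d - 1) * n.choose u ^ (d - 1) := by
    calc n ^ (d - 2) * n.choose (u / 2) ^ d ≤ n ^ (d - 2) * (n ^ (u / 2)) ^ d :=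
          Nat.mul_le_mul_left _ (Nat.pow_le_pow_left (Nat.choose_le_pow _ _) d)
      _ = n ^ (d - 2 + u / 2 * d) := by rw [← pow_mul, ← pow_add]
      _ ≤ n ^ (u * (d - 1)) := Nat.pow_le_pow_right (by omega) hexp
      _ = (n ^ u) ^ (d - 1) := by rw [pow_mul]
      _ ≤ (u ^ u * n.choose u) ^ (d - 1) :=
          Nat.pow_le_pow_left (Nat.pow_le_pow_mul_choose hun) _
      _ = (u ^ u) ^ (d - 1) * n.choose u ^ (d - 1) := by rw [mul_pow]
      _ ≤ _ := Nat.mul_le_mul_right _ (Nat.pow_le_pow_left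
          ((Nat.pow_le_pow_left huS u).trans (Nat.pow_le_pow_right (by omega) huS)) _)
  calc (n.choose u : ℝ) * n ^ (d - 2) * p ^ d
      ≤ n.choose u * n ^ (d - 2) * (n.choose (u / 2) / n.choose u) ^ d :=
        mul_le_mul_of_nonneg_left (pow_le_pow_left₀ hp0 hp d) (by positivity)
    _ = (n ^ (d - 2) * n.choose (u / 2) ^ d : ℝ) / n.choose u ^ (d - 1) := by
        obtain ⟨e, rfl⟩ := Nat.exists_eq_add_of_le hd
        rw [show 2 + e - 1 = e + 1 by omega, show 2 + e = (e + 1) + 1 by omega, div_pow,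
          pow_succ (n.choose u : ℝ) (e + 1)]
        field_simp
    _ ≤ ((S ^ S) ^ (d - 1) * n.choose u ^ (d - 1) : ℝ) / n.choose u ^ (d - 1) := by
        refine div_le_div_of_nonneg_right ?_ (by positivity)
        exact_mod_cast hnat
    _ = _ := by field_simp

theorem uniformProb_perm_joining {V : Type} [Fintype V] [DecidableEq V] (A B : Finset V) :
    uniformProb (Perm V) (fun π => π • A ⊆ B ∧ A ⊆ π • B) =
      (joiningPerms A B).card / (Fintype.card V).factorial := by
  classical
  rw [uniformProb_eq_card_filter, Fintype.card_perm]
  congr 3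
  ext π
  simp [joiningPerms]

theorem probG_bound {d : ℕ} (he : Even d) (hd : 4 ≤ d) {n : ℕ}
    (hn : smallSize (d / 2 - 1) ^ 2 ≤ n) :
    1 - (2 * smallSize (d / 2 - 1) * 1 + 3) / (n : ℝ) ^ (d / 2 - 1) ≤
      probG n d fun G => G.IsSpreader d (1 / smallSize (d / 2 - 1)) ∧ G.NontrivialEigenvaluesLE
        ((d : ℝ) - (1 / smallSize (d / 2 - 1)) ^ 2 / (4 * d ^ 3)) := by
  have hS : 4 ≤ smallSize (d / 2 - 1) := by unfold smallSize; omega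
  set S₀ := smallSize (d / 2 - 1) with hS₀
  have hSn : S₀ * 4 ≤ n := le_trans (by rw [pow_two]; exact Nat.mul_le_mul_left _ hS) hn
  refine uniformProb_spreader_ge zero_le_one (by omega) (by omega) (by omega) (by omega)
    (fun π : Perm (Fin n) => π) (fun π => LoopGraph.ofPerms π) (fun π => ?_)
    (fun π A => LoopGraph.neighbors_ofPerms π A) ?_ ?_
  · have := LoopGraph.isRegular_ofPerms π
    rwa [Nat.mul_div_cancel' he.two_dvd] at this
  · intro U hU0 hU1
    have hc := card_joiningPerms_mul_le (le_refl U.card)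
    rw [Nat.sub_self, Nat.choose_zero_right, one_pow, one_mul, Fintype.card_fin] at hc
    have hc' := (Nat.mul_le_mul_left _ (choose_le_card_similarPairs U U)).trans hc
    rw [Fintype.card_fin] at hc'
    have hun : 2 * U.card ≤ n := by omega
    have hC : n ≤ n.choose U.card := by
      have := Nat.choose_le_choose_right_of_le_half (a := 1) hU0 hun
      rwa [Nat.choose_one_right] at this
    have hC0 : (0 : ℝ) < n.choose U.card := by exact_mod_cast (by omega : 0 < n.choose U.card)
    have hp : uniformProb (Perm (Fin n)) (fun π => π • U = U) ≤ 1 / n.choose U.card := by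
      have e : uniformProb (Perm (Fin n)) (fun π => π • U = U) =
          (joiningPerms U U).card / n.factorial := by
        have := uniformProb_perm_joining U U
        rw [Fintype.card_fin] at this
        rw [← this]
        congr 1
        ext π
        exact ⟨fun h => ⟨h.subset, h.symm.subset⟩, fun h => h.1.antisymm h.2⟩
      rw [e, div_le_div_iff₀ (by exact_mod_cast n.factorial_pos) hC0, one_mul]
      exact_mod_cast hc'
    -- Since `n ≤ C(n,u)`, the `d / 2` factors `1 / C(n,u)` cancel the number of sets and every
    -- power of `n`.
    calc (n.choose U.card : ℝ) * n ^ (d / 2 - 1) *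
          uniformProb (Perm (Fin n)) (fun π => π • U = U) ^ (d / 2)
        ≤ n.choose U.card * (n.choose U.card : ℝ) ^ (d / 2 - 1) *
          (1 / n.choose U.card) ^ (d / 2) := by
          have h0 := uniformProb_nonneg (Ω := Perm (Fin n)) (fun π => π • U = U)
          gcongr
      _ = 1 := by
          rw [← pow_succ', Nat.sub_add_cancel (by omega), ← mul_pow, mul_one_div_cancel hC0.ne',
            one_pow]
  · refine sum_le_of_le_joinBound hn (P := fun A B => uniformProb (Perm (Fin n))
      (fun ω => ω • A ⊆ B ∧ A ⊆ ω • B) ^ (d / 2)) fun A B => ?_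
    refine pow_le_joinBound_of_le (by omega) (uniformProb_nonneg _) (uniformProb_le_one _) ?_
    rw [uniformProb_perm_joining]
    refine cast_div_le_mul_div (Nat.factorial_pos _) le_rfl ?_
    rw [Fintype.card_fin]
    exact Nat.le_mul_of_pos_right _ (by omega)

theorem not_smul_eq_of_sameCycle {V : Type} [Fintype V] [DecidableEq V] {π : Perm V}
    (h : ∀ x y, π.SameCycle x y) {U : Finset V} (h0 : 0 < U.card) (h1 : U.card < Fintype.card V) :
    π • U ≠ U := by
  intro hU
  obtain ⟨x, hx⟩ := Finset.card_pos.1 h0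
  obtain ⟨y, hy⟩ : ∃ y, y ∉ U := by
    by_contra hc
    push Not at hc
    rw [Finset.eq_univ_iff_forall.2 hc, Finset.card_univ] at h1
    exact lt_irrefl _ h1
  obtain ⟨k, rfl⟩ := (h x y).exists_nat_pow_eq
  refine hy ?_
  clear hy
  induction k with
  | zero => exact hx
  | succ k ih =>
    rw [pow_succ', Perm.mul_apply, ← hU]
    exact Finset.smul_mem_smul_finset ih

/-- A full cycle leaves no proper nonempty set invariant, so small sets contribute `0` and `m` is
arbitrary. -/
theorem probH_bound {d m : ℕ} (he : Even d) (hd : 4 ≤ d) {n : ℕ}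
    (hn : smallSize m ^ 2 ≤ n) :
    1 - (2 * smallSize m * 0 + 3) / (n : ℝ) ^ m ≤
      probH n d fun G => G.IsSpreader d (1 / smallSize m) ∧ G.NontrivialEigenvaluesLE
        ((d : ℝ) - (1 / smallSize m) ^ 2 / (4 * d ^ 3)) := by
  classical
  have hS : 4 ≤ smallSize m := by unfold smallSize; omega
  have hSn : smallSize m * 4 ≤ n :=
    le_trans (by rw [pow_two]; exact Nat.mul_le_mul_left _ hS) hn
  have hcount := factorial_le_card_fullCycle (V := Fin n) (by rw [Fintype.card_fin]; omega)
  have hne : Nonempty (FullCycle n) := by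
    by_contra h0
    rw [not_nonempty_iff] at h0
    rw [Nat.card_of_isEmpty] at hcount
    simp [Nat.factorial_ne_zero] at hcount
  refine uniformProb_spreader_ge le_rfl (by omega) (by omega) (by omega) (by omega)
    (fun π : FullCycle n => π.1) (fun π => LoopGraph.ofPerms fun j => (π j).1) (fun π => ?_)
    (fun π A => LoopGraph.neighbors_ofPerms _ A) ?_ ?_
  · have := LoopGraph.isRegular_ofPerms fun j => (π j).1
    rwa [Nat.mul_div_cancel' he.two_dvd] at this
  · intro U hU0 hU1
    have : uniformProb (FullCycle n) (fun ω => ω.1 • U = U) = 0 := by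
      rw [uniformProb]
      have : IsEmpty {ω : FullCycle n // ω.1 • U = U} :=
        ⟨fun ω => not_smul_eq_of_sameCycle ω.1.2 hU0 (by rw [Fintype.card_fin]; omega) ω.2⟩
      rw [Nat.card_of_isEmpty]
      simp
    rw [this, zero_pow (by omega), mul_zero]
  · refine sum_le_of_le_joinBound hn (P := fun A B => uniformProb (FullCycle n)
      (fun ω => ω.1 • A ⊆ B ∧ A ⊆ ω.1 • B) ^ (d / 2)) fun A B => ?_
    refine pow_le_joinBound_of_le (by omega) (uniformProb_nonneg _) (uniformProb_le_one _) ?_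
    rw [uniformProb_subtype (fun π : Perm (Fin n) => ∀ x y, π.SameCycle x y)
      fun π => π • A ⊆ B ∧ A ⊆ π • B]
    refine cast_div_le_mul_div (Nat.factorial_pos _) (natCard_subtype_le_card fun π hπ => ?_) hcount
    exact Finset.mem_filter.2 ⟨Finset.mem_univ _, hπ.2⟩

/-- The probability that a random matching with at most one unmatched vertex leaves a given set
invariant. -/
theorem uniformProb_invariant_le {n : ℕ} {p : Perm (Fin n) → Prop}
    (hconj : ∀ τ σ, p σ → p (τ * σ * τ⁻¹)) (hinv : ∀ σ, p σ → ∀ x, σ (σ x) = x)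
    (hfix : ∀ σ, p σ → ∀ x y, σ x = x → σ y = y → x = y) (U : Finset (Fin n)) :
    uniformProb {σ // p σ} (fun σ => σ.1 • U = U) ≤
      n.choose (U.card / 2) / n.choose U.card := by
  classical
  have h := card_invariant_mul_choose_le (Finset.univ.filter p) (U := U)
    (b := n.choose (U.card / 2)) (fun τ σ hσ => by
      simpa using hconj τ σ (by simpa using hσ)) (fun σ hσ => by
      have hσ' : p σ := by simpa using hσ
      simpa using card_invariant_le (hinv σ hσ') (hfix σ hσ') U.card)
  rw [Fintype.card_fin, Finset.filter_filter] at h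
  have hun : U.card ≤ n := by simpa using Finset.card_le_univ U
  have hC : (0 : ℝ) < n.choose U.card := by exact_mod_cast Nat.choose_pos hun
  rw [uniformProb_subtype p fun σ => σ • U = U, Nat.card_eq_fintype_card, Fintype.card_subtype,
    Nat.card_eq_fintype_card, Fintype.card_subtype]
  rcases Nat.eq_zero_or_pos (Finset.univ.filter p).card with h0 | h0
  · rw [h0, Nat.cast_zero, div_zero]; positivity
  · rw [div_le_div_iff₀ (by exact_mod_cast h0) hC, mul_comm (Nat.cast _) (Nat.cast (Finset.card _))]
    exact_mod_cast h

theorem conj_apply_eq_self_iff {V : Type} (τ σ : Perm V) (x : V) :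
    (τ * σ * τ⁻¹) x = x ↔ σ (τ⁻¹ x) = τ⁻¹ x := by
  rw [Perm.mul_apply, Perm.mul_apply, Perm.eq_inv_iff_eq]

theorem involutive_conj {V : Type} {σ : Perm V} (h : ∀ x, σ (σ x) = x) (τ : Perm V) (x : V) :
    (τ * σ * τ⁻¹) ((τ * σ * τ⁻¹) x) = x := by
  simp [h]

theorem probI_bound {d : ℕ} (hd : 3 ≤ d) {n : ℕ} (he : Even n)
    (hn : smallSize (d - 2) ^ 2 ≤ n) :
    1 - (2 * smallSize (d - 2) *
        ((2 * smallSize (d - 2) : ℕ) ^ (2 * smallSize (d - 2)) : ℝ) ^ (d - 1) + 3) /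
        (n : ℝ) ^ (d - 2) ≤
      probI n d fun G => G.IsSpreader d (1 / smallSize (d - 2)) ∧ G.NontrivialEigenvaluesLE
        ((d : ℝ) - (1 / smallSize (d - 2)) ^ 2 / (4 * d ^ 3)) := by
  classical
  have hS : 4 ≤ smallSize (d - 2) := by unfold smallSize; omega
  have hSn : smallSize (d - 2) * 4 ≤ n :=
    le_trans (by rw [pow_two]; exact Nat.mul_le_mul_left _ hS) hn
  have hcount := factorial_le_card_perfectMatching (V := Fin n) (by rw [Fintype.card_fin]; omega)
    (by rwa [Fintype.card_fin])
  have hne : Nonempty (PerfectMatching n) := by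
    by_contra h0
    rw [not_nonempty_iff] at h0
    rw [Nat.card_of_isEmpty] at hcount
    simp [Nat.factorial_ne_zero] at hcount
  refine uniformProb_spreader_ge (by positivity) (by omega) (by omega) (by omega) (by omega)
    (fun σ : PerfectMatching n => σ.1)
    (fun σ => LoopGraph.ofInvolutions (fun j => (σ j).1) fun j => (σ j).2.1)
    (fun σ => LoopGraph.isRegular_ofInvolutions _ _)
    (fun σ A => LoopGraph.neighbors_ofInvolutions _ _ A) ?_ ?_
  · intro U hU0 hU1
    refine choose_mul_pow_mul_le (by omega) hU0 (by omega) hU1.le (uniformProb_nonneg _) ?_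
    refine uniformProb_invariant_le (fun τ σ h => ⟨involutive_conj h.1 τ, fun x hx => ?_⟩)
      (fun σ h => h.1) (fun σ h x y hx _ => absurd hx (h.2 x)) U
    exact h.2 _ ((conj_apply_eq_self_iff τ σ x).1 hx)
  · refine sum_le_of_le_joinBound hn (P := fun A B => uniformProb (PerfectMatching n)
      (fun ω => ω.1 • A ⊆ B ∧ A ⊆ ω.1 • B) ^ d) fun A B => ?_
    refine pow_le_joinBound_of_sq_le hd (uniformProb_nonneg _) (uniformProb_le_one _) ?_
    rw [uniformProb_subtype (fun σ : Perm (Fin n) => (∀ x, σ (σ x) = x) ∧ ∀ x, σ x ≠ x)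
      fun π => π • A ⊆ B ∧ A ⊆ π • B]
    refine cast_div_sq_le_mul_div (Nat.factorial_pos _) (le_trans (Nat.pow_le_pow_left
      (natCard_subtype_le_card fun σ hσ => ?_) 2) (card_joiningMatchings_sq_le A B)) hcount
    obtain ⟨h1, h2⟩ := hσ
    exact mem_joiningMatchings.2 ⟨h1.1, h1.2, h2.1⟩

theorem probJ_bound {d : ℕ} (hd : 3 ≤ d) {n : ℕ} (ho : Odd n)
    (hn : smallSize (d - 2) ^ 2 ≤ n) :
    1 - (2 * smallSize (d - 2) *
        ((2 * smallSize (d - 2) : ℕ) ^ (2 * smallSize (d - 2)) : ℝ) ^ (d - 1) + 3) /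
        (n : ℝ) ^ (d - 2) ≤
      probJ n d fun G => G.IsSpreader d (1 / smallSize (d - 2)) ∧ G.NontrivialEigenvaluesLE
        ((d : ℝ) - (1 / smallSize (d - 2)) ^ 2 / (4 * d ^ 3)) := by
  classical
  have hS : 4 ≤ smallSize (d - 2) := by unfold smallSize; omega
  have hSn : smallSize (d - 2) * 4 ≤ n :=
    le_trans (by rw [pow_two]; exact Nat.mul_le_mul_left _ hS) hn
  have hcount := factorial_le_card_nearPerfectMatching (V := Fin n)
    (by rw [Fintype.card_fin]; omega) (by rwa [Fintype.card_fin])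
  have hne : Nonempty (NearPerfectMatching n) := by
    by_contra h0
    rw [not_nonempty_iff] at h0
    rw [Nat.card_of_isEmpty] at hcount
    simp [Nat.factorial_ne_zero] at hcount
  refine uniformProb_spreader_ge (by positivity) (by omega) (by omega) (by omega) (by omega)
    (fun σ : NearPerfectMatching n => σ.1)
    (fun σ => LoopGraph.ofInvolutions (fun j => (σ j).1) fun j => (σ j).2.1)
    (fun σ => LoopGraph.isRegular_ofInvolutions _ _)
    (fun σ A => LoopGraph.neighbors_ofInvolutions _ _ A) ?_ ?_
  · intro U hU0 hU1
    refine choose_mul_pow_mul_le (by omega) hU0 (by omega) hU1.le (uniformProb_nonneg _) ?_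
    refine uniformProb_invariant_le (fun τ σ h => ⟨involutive_conj h.1 τ, ?_⟩)
      (fun σ h => h.1) (fun σ h x y hx hy => h.2.unique hx hy) U
    obtain ⟨x, hx, hx'⟩ := h.2
    refine ⟨τ x, (conj_apply_eq_self_iff τ σ _).2 (by simpa using hx), fun y hy => ?_⟩
    rw [← hx' _ ((conj_apply_eq_self_iff τ σ y).1 hy)]
    simp
  -- Unlike for perfect matchings, the pairs of sets are compared inside `Option (Fin n)`, where
  -- near perfect matchings are perfect.
  · refine sum_le_of_le_joinBound_option hn (P := fun A B => uniformProb (NearPerfectMatching n)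
      (fun ω => ω.1 • A ⊆ B ∧ A ⊆ ω.1 • B) ^ d) fun A B => ?_
    refine pow_le_joinBound_of_sq_le hd (uniformProb_nonneg _) (uniformProb_le_one _) ?_
    rw [uniformProb_subtype (fun σ : Perm (Fin n) => (∀ x, σ (σ x) = x) ∧ ∃! x, σ x = x)
      fun π => π • A ⊆ B ∧ A ⊆ π • B, Fintype.card_option]
    refine cast_div_sq_le_mul_div (Nat.factorial_pos _) (le_trans (Nat.pow_le_pow_left
      (le_trans (natCard_subtype_le_card fun σ hσ => ?_) (card_joiningNearMatchings_le A B)) 2)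
      (card_joiningMatchings_sq_le _ _)) hcount
    obtain ⟨h1, h2⟩ := hσ
    exact mem_joiningNearMatchings.2 ⟨h1.1, h1.2, h2.1⟩

end Models

/-- In each of the four models of random `d`-regular graphs on `n` vertices there are `γ, ε > 0`,
depending only on `d`, such that with probability `1 - O(n ^ (-τ_fund))` the graph is a
`γ`-spreader and satisfies `|λ_i| ≤ d - ε` for all `i > 1`. -/
theorem mainTheorem10 :
    (∀ d : ℕ, Even d → 4 ≤ d →
      ∃ γ : ℝ, 0 < γ ∧ ∃ ε : ℝ, 0 < ε ∧ ∃ C : ℝ, ∀ n : ℕ, 0 < n →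
        1 - C * (n : ℝ) ^ (-tauFundG d) ≤
          probG n d (fun G => G.IsSpreader d γ ∧ G.NontrivialEigenvaluesLE ((d : ℝ) - ε))) ∧
    (∀ d : ℕ, Even d → 4 ≤ d →
      ∃ γ : ℝ, 0 < γ ∧ ∃ ε : ℝ, 0 < ε ∧ ∃ C : ℝ, ∀ n : ℕ, 0 < n →
        1 - C * (n : ℝ) ^ (-tauFundHIJ d) ≤
          probH n d (fun G => G.IsSpreader d γ ∧ G.NontrivialEigenvaluesLE ((d : ℝ) - ε))) ∧
    (∀ d : ℕ, 3 ≤ d →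
      ∃ γ : ℝ, 0 < γ ∧ ∃ ε : ℝ, 0 < ε ∧ ∃ C : ℝ, ∀ n : ℕ, 0 < n → Even n →
        1 - C * (n : ℝ) ^ (-tauFundHIJ d) ≤
          probI n d (fun G => G.IsSpreader d γ ∧ G.NontrivialEigenvaluesLE ((d : ℝ) - ε))) ∧
    (∀ d : ℕ, 3 ≤ d →
      ∃ γ : ℝ, 0 < γ ∧ ∃ ε : ℝ, 0 < ε ∧ ∃ C : ℝ, ∀ n : ℕ, Odd n →
        1 - C * (n : ℝ) ^ (-tauFundHIJ d) ≤
          probJ n d (fun G => G.IsSpreader d γ ∧ G.NontrivialEigenvaluesLE ((d : ℝ) - ε))) := by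
  have hS : ∀ m, 0 < smallSize m := fun m => by unfold smallSize; omega
  refine ⟨fun d he hd => ?_, fun d he hd => ?_, fun d hd => ?_, fun d hd => ?_⟩
  · obtain ⟨γ, hγ, ε, hε, C, hC⟩ := exists_constants_of_eventually (d := d) (by omega) (hS _)
      (by positivity) (tauFundG_le hd he) (fun _ => True)
      (fun γ ε n => probG n d fun G => G.IsSpreader d γ ∧ G.NontrivialEigenvaluesLE ((d : ℝ) - ε))
      (fun _ _ _ => uniformProb_nonneg _) (fun n hn _ _ => probG_bound he hd hn)
    exact ⟨γ, hγ, ε, hε, C, fun n hn => hC n hn trivial⟩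
  · obtain ⟨γ, hγ, ε, hε, C, hC⟩ := exists_constants_of_eventually (d := d) (by omega) (hS _)
      (by positivity) (tauFundHIJ_le (by omega : 3 ≤ d)) (fun _ => True)
      (fun γ ε n => probH n d fun G => G.IsSpreader d γ ∧ G.NontrivialEigenvaluesLE ((d : ℝ) - ε))
      (fun _ _ _ => uniformProb_nonneg _) (fun n hn _ _ => probH_bound he hd hn)
    exact ⟨γ, hγ, ε, hε, C, fun n hn => hC n hn trivial⟩
  · exact exists_constants_of_eventually (d := d) (by omega) (hS _)
      (by positivity) (tauFundHIJ_le hd) Even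
      (fun γ ε n => probI n d fun G => G.IsSpreader d γ ∧ G.NontrivialEigenvaluesLE ((d : ℝ) - ε))
      (fun _ _ _ => uniformProb_nonneg _) (fun n hn _ he => probI_bound hd he hn)
  · obtain ⟨γ, hγ, ε, hε, C, hC⟩ := exists_constants_of_eventually (d := d) (by omega) (hS _)
      (by positivity) (tauFundHIJ_le hd) Odd
      (fun γ ε n => probJ n d fun G => G.IsSpreader d γ ∧ G.NontrivialEigenvaluesLE ((d : ℝ) - ε))
      (fun _ _ _ => uniformProb_nonneg _) (fun n hn _ ho => probJ_bound hd ho hn)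
    exact ⟨γ, hγ, ε, hε, C, fun n hn => hC n hn.pos hn⟩
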